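/- **Posterior Cramér–Rao bound (PCRB) for the angle under hybrid transceiver arrays.** *Model.* Let $N_R\ge 1$, $N_{RF,R}\mid N_R$, and let $W_{RF}^H\in\mathbb C^{N_{RF,R}\times N_R}$ be the analog combiner of a partially-connected array: with $m=N_R/N_{RF,R}$, $|[W_{RF}^H]_{i,j}|=1$ if $(i-1)m+1\le j\le im$ and $[W_{RF}^H]_{i,j}=0$ otherwise. Let $V_{RF}\in\mathbb C^{N_T\times N_{RF,T}}$ be the transmit analog beamformer (unit-modulus entries for a fully-connected hybrid array; no restriction on $V_{RF}$ is needed), $V_{BB}\in\mathbb C^{N_{RF,T}\times N_S}$ the digital beamformer and $R_{BB}=V_{BB}V_{BB}^H$. Let $a:\mathbb R\to\mathbb C^{N_T}$, $b:\mathbb R\to\mathbb C^{N_R}$ be differentiable steering vectors, $M(\theta)=b(\theta)a(\theta)^H$, $\sigma_S^2>0$. For a block of known symbols $S=[s_1,\dots,s_L]\in\mathbb C^{N_S\times L}$, $L\ge1$, the observation is $$y=u+\mathrm{vec}(W_{RF}^HN),\qquad u=\alpha\,\mathrm{vec}\big(W_{RF}^HM(\theta)V_{RF}V_{BB}S\big),$$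 where the columns of $N$ are independent $\mathcal{CN}(0,\sigma_S^2I_{N_R})$ and independent of the unknown parameter $\zeta=(\theta,\alpha_R,\alpha_I)$, $\alpha=\alpha_R+j\alpha_I$. The prior density of $\zeta$ is $p_Z(\zeta)=p_\Theta(\theta)\,p_\alpha(\alpha_R,\alpha_I)$, where $p_\Theta$ and $p_\alpha$ are differentiable probability densities on $\mathbb R$ and $\mathbb R^2$ with finite Fisher information, $\mathbb E[\alpha]=0$ and $\gamma=\mathbb E[|\alpha|^2]<\infty$. The entries of $M(\theta)$ and of $\dot M(\theta)$ are square integrable with respect to $p_\Theta(\theta)\,d\theta$. Put $A_1(W_{RF}^H)=\int\dot M(\theta)^HW_{RF}W_{RF}^H\dot M(\theta)p_\Theta(\theta)\,d\theta$, $A_2(W_{RF}^H)=\int M(\theta)^HW_{RF}W_{RF}^HM(\theta)p_\Theta(\theta)\,d\theta$, $x_l=V_{RF}V_{BB}s_l$, $R_X=\frac1L\sum_{l=1}^Lx_lx_l^H$ and $\tilde R_X=V_{RF}R_{BB}V_{RF}^H$. For an $N_T\times N_T$ matrix $R$ let $$\Phi_L(R)=\frac{1}{\mathbb E\Big[\big(\tfrac{\partial\ln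 p_\Theta(\theta)}{\partial\theta}\big)^2\Big]+\frac{2N_{RF,R}L\gamma}{N_R\sigma_S^2}\,\mathrm{tr}\big(A_1(W_{RF}^H)R\big)}.$$ The posterior Fisher information matrix is $F=F_O+F_P$ with $[F_O]_{i,j}=\mathbb E_{y,\zeta}[\partial_{\zeta_i}\ln p(y|\zeta)\,\partial_{\zeta_j}\ln p(y|\zeta)]$ and $[F_P]_{i,j}=\mathbb E_\zeta[\partial_{\zeta_i}\ln p_Z(\zeta)\,\partial_{\zeta_j}\ln p_Z(\zeta)]$, and $\mathrm{PCRB}_\theta=[F^{-1}]_{1,1}$. *Claim.* (1) For every $L\ge1$ and every $S$: - the noise stays white after combining: $C_y=\sigma_S^2(I_L\otimes W_{RF}^H)(I_L\otimes W_{RF}^H)^H=\frac{N_R}{N_{RF,R}}\sigma_S^2I$, and given $\zeta$ the observation $y$ has the $\mathcal{CN}(u,C_y)$ density; - $[F_O]_{i,j}=2\,\mathbb E_\zeta\big[\mathrm{Re}\{(\partial u/\partial\zeta_i)^HC_y^{-1}\,\partial u/\partial\zeta_j\}\big]$, and in blocks $J_{\theta\theta}=\frac{2N_{RF,R}L\gamma}{N_R\sigma_S^2}\mathrm{tr}(A_1(W_{RF}^H)R_X)$,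 $J_{\theta\alpha}=0$, $J_{\alpha\alpha}=\frac{2N_{RF,R}L}{N_R\sigma_S^2}\mathrm{tr}(A_2(W_{RF}^H)R_X)I_2$; - $F$ is positive definite and $\mathrm{PCRB}_\theta=\Phi_L(R_X)$; in particular, if $R_X=\tilde R_X$, then $$\mathrm{PCRB}_\theta=\Phi_L(V_{RF}R_{BB}V_{RF}^H);$$ - $\mathbb E[(\hat\theta(y)-\theta)^2]\ge\mathrm{PCRB}_\theta$ for every measurable estimator $\hat\theta$ of $\theta$ from the analog-combined signal $y$. (2) If $s_1,s_2,\dots$ are i.i.d. $\mathcal{CN}(0,I_{N_S})$, then almost surely, as $L\to\infty$, $R_X\to\tilde R_X$ and $\mathrm{PCRB}_\theta/\Phi_L(V_{RF}R_{BB}V_{RF}^H)\to1$. -/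

import Mathlib

open MeasureTheory ProbabilityTheory Filter Topology Matrix
open scoped NNReal ENNReal Kronecker

noncomputable section

/-- The law `CN(0, v)` of a circularly symmetric complex Gaussian scalar: real and imaginary parts
are independent real Gaussians with mean `0` and variance `v / 2`. -/
def cscg (v : ℝ≥0) : Measure ℂ :=
  ((gaussianReal 0 (v / 2)).prod (gaussianReal 0 (v / 2))).map (fun x : ℝ × ℝ => (⟨x.1, x.2⟩ : ℂ))

/-- The law `CN(0, v I)` of a white circularly symmetric complex Gaussian vector. -/
def whiteCSCG (ι : Type) [Fintype ι] (v : ℝ≥0) : Measure (ι → ℂ) :=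
  Measure.pi (fun _ : ι => cscg v)

/-- The Lebesgue density of the law `CN(u, C)` on `ι → ℂ`,
`exp (- (y - u)ᴴ C⁻¹ (y - u)) / (π ^ n * det C)` with `n` the number of coordinates. -/
def cscgPDF {ι : Type} [Fintype ι] [DecidableEq ι] (u : ι → ℂ) (C : Matrix ι ι ℂ) (y : ι → ℂ) : ℝ :=
  Real.exp (-(star (y - u) ⬝ᵥ (C⁻¹ *ᵥ (y - u))).re) / (Real.pi ^ Fintype.card ι * C.det.re)

/-- The partial derivative of `f` with respect to the `i`-th coordinate of
`ζ = (θ, α_R, α_I)` (coordinates `0, 1, 2`). -/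
def partialDeriv {E : Type} [NormedAddCommGroup E] [NormedSpace ℝ E]
    (f : (Fin 3 → ℝ) → E) (i : Fin 3) (ζ : Fin 3 → ℝ) : E :=
  deriv (fun t => f (Function.update ζ i t)) (ζ i)

/-- `WH` is the analog combining matrix `W_RFᴴ` of a partially-connected array: the antennas are
split into consecutive blocks of `NR / NRFR` antennas, and the `i`-th RF chain is connected to
exactly the antennas of the `i`-th block, through unit-modulus phase shifters. -/
def IsPartiallyConnected {NR NRFR : ℕ} (WH : Matrix (Fin NRFR) (Fin NR) ℂ) : Prop :=
  ∀ (i : Fin NRFR) (j : Fin NR),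
    ‖WH i j‖ =
      if (i : ℕ) * (NR / NRFR) ≤ (j : ℕ) ∧ (j : ℕ) < ((i : ℕ) + 1) * (NR / NRFR) then 1 else 0

/-- The data of the sensing system with hybrid transmit and receive arrays:
`NT`, `NR` transmit and receive antennas, `NRFT`, `NRFR` transmit and receive RF chains, and
`NS` data streams. -/
structure HybridSystem (NT NR NRFT NRFR NS : ℕ) where
  /-- transmit steering vector `a(θ)` -/
  a : ℝ → Fin NT → ℂ
  /-- receive steering vector `b(θ)` -/
  b : ℝ → Fin NR → ℂ
  /-- prior density of the angle `θ` -/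
  pTheta : ℝ → ℝ
  /-- prior joint density of `(α_R, α_I)` -/
  pAlpha : ℝ × ℝ → ℝ
  /-- receive analog beamforming matrix `W_RFᴴ` -/
  WH : Matrix (Fin NRFR) (Fin NR) ℂ
  /-- transmit analog beamforming matrix `V_RF`; in a fully-connected array its entries have modulus
  one, in a fully-digital one it is the identity, and nothing below restricts it -/
  VRF : Matrix (Fin NT) (Fin NRFT) ℂ
  /-- transmit digital beamforming matrix `V_BB` -/
  VBB : Matrix (Fin NRFT) (Fin NS) ℂ
  /-- receiver noise power `σ_S²` -/
  noiseVar : ℝ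

namespace HybridSystem

variable {NT NR NRFT NRFR NS : ℕ} (sys : HybridSystem NT NR NRFT NRFR NS)

/-- `M(θ) = b(θ) a(θ)ᴴ`. -/
def M (θ : ℝ) : Matrix (Fin NR) (Fin NT) ℂ := vecMulVec (sys.b θ) (star (sys.a θ))

/-- The entrywise derivative of `M` with respect to `θ`. -/
def Mdot (θ : ℝ) : Matrix (Fin NR) (Fin NT) ℂ :=
  Matrix.of fun i j => deriv (fun t => sys.M t i j) θ

/-- `R_BB = V_BB V_BBᴴ`. -/
def RBB : Matrix (Fin NRFT) (Fin NRFT) ℂ := sys.VBB * sys.VBBᴴ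

/-- The transmitted block `[x_1, …, x_L] = V_RF V_BB S`. -/
def transmitted {L : ℕ} (S : Matrix (Fin NS) (Fin L) ℂ) : Matrix (Fin NT) (Fin L) ℂ :=
  sys.VRF * sys.VBB * S

/-- The sample covariance matrix `(1 / L) ∑ x_l x_lᴴ`. -/
def sampleCov {L : ℕ} (S : Matrix (Fin NS) (Fin L) ℂ) : Matrix (Fin NT) (Fin NT) ℂ :=
  (L : ℂ)⁻¹ • ∑ l : Fin L,
    vecMulVec (fun i => sys.transmitted S i l) (star fun i => sys.transmitted S i l)

/-- The noise-free vectorized received signal `u = α vec(W_RFᴴ b(θ) a(θ)ᴴ V_RF V_BB S)`. -/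
def signal {L : ℕ} (S : Matrix (Fin NS) (Fin L) ℂ) (ζ : Fin 3 → ℝ) : Fin L × Fin NRFR → ℂ :=
  (⟨ζ 1, ζ 2⟩ : ℂ) • vec (sys.WH * sys.M (ζ 0) * sys.transmitted S)

/-- The conditional law of the observation `y = vec(α W_RFᴴ M(θ) V_RF V_BB S + W_RFᴴ N)`
given `ζ`, where the columns of `N` are independent `CN(0, σ_S² I)` vectors. -/
def obsLaw {L : ℕ} (S : Matrix (Fin NS) (Fin L) ℂ) (ζ : Fin 3 → ℝ) :
    Measure (Fin L × Fin NRFR → ℂ) :=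
  (Measure.pi fun _ : Fin L => whiteCSCG (Fin NR) sys.noiseVar.toNNReal).map
    (fun n => sys.signal S ζ + vec (sys.WH * Matrix.of fun i l => n l i))

/-- The effective noise covariance `C_y = σ_S² (I_L ⊗ W_RFᴴ) (I_L ⊗ W_RFᴴ)ᴴ`. -/
def noiseCov (L : ℕ) : Matrix (Fin L × Fin NRFR) (Fin L × Fin NRFR) ℂ :=
  (sys.noiseVar : ℂ) • (((1 : Matrix (Fin L) (Fin L) ℂ) ⊗ₖ sys.WH) *
    ((1 : Matrix (Fin L) (Fin L) ℂ) ⊗ₖ sys.WH)ᴴ)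

/-- The likelihood `p(y | ζ)`: the density of `CN(u, C_y)`. -/
def likelihood {L : ℕ} (S : Matrix (Fin NS) (Fin L) ℂ) (ζ : Fin 3 → ℝ)
    (y : Fin L × Fin NRFR → ℂ) : ℝ :=
  cscgPDF (sys.signal S ζ) (sys.noiseCov L) y

/-- The prior density `p_Z(ζ) = p_Θ(θ) p_α(α_R, α_I)`. -/
def priorPDF (ζ : Fin 3 → ℝ) : ℝ := sys.pTheta (ζ 0) * sys.pAlpha (ζ 1, ζ 2)

/-- The prior law of `ζ`. -/
def prior : Measure (Fin 3 → ℝ) :=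
  (volume : Measure (Fin 3 → ℝ)).withDensity fun ζ => ENNReal.ofReal (sys.priorPDF ζ)

/-- The Fisher information matrix from the observation,
`E_{y,ζ}[∂_i ln p(y | ζ) ∂_j ln p(y | ζ)]`. -/
def fimObs {L : ℕ} (S : Matrix (Fin NS) (Fin L) ℂ) : Matrix (Fin 3) (Fin 3) ℝ :=
  Matrix.of fun i j => ∫ ζ, ∫ y,
    partialDeriv (fun ζ' => Real.log (sys.likelihood S ζ' y)) i ζ *
      partialDeriv (fun ζ' => Real.log (sys.likelihood S ζ' y)) j ζ ∂(sys.obsLaw S ζ) ∂sys.prior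

/-- The Fisher information matrix from the prior, `E_ζ[∂_i ln p_Z(ζ) ∂_j ln p_Z(ζ)]`. -/
def fimPrior : Matrix (Fin 3) (Fin 3) ℝ :=
  Matrix.of fun i j => ∫ ζ,
    partialDeriv (fun ζ' => Real.log (sys.priorPDF ζ')) i ζ *
      partialDeriv (fun ζ' => Real.log (sys.priorPDF ζ')) j ζ ∂sys.prior

/-- The posterior Fisher information matrix. -/
def pfim {L : ℕ} (S : Matrix (Fin NS) (Fin L) ℂ) : Matrix (Fin 3) (Fin 3) ℝ :=
  sys.fimObs S + sys.fimPrior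

/-- The posterior Cramér-Rao bound for `θ`: the `(θ, θ)` entry of the inverse of the posterior
Fisher information matrix. -/
def pcrbTheta {L : ℕ} (S : Matrix (Fin NS) (Fin L) ℂ) : ℝ := (sys.pfim S)⁻¹ 0 0

/-- `E_θ[(∂ ln p_Θ(θ) / ∂θ)²]`. -/
def priorInfoTheta : ℝ :=
  ∫ θ, (deriv (fun t => Real.log (sys.pTheta t)) θ) ^ 2 * sys.pTheta θ

/-- `γ = E[α_R² + α_I²]`. -/
def gam : ℝ := ∫ x : ℝ × ℝ, (x.1 ^ 2 + x.2 ^ 2) * sys.pAlpha x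

/-- `A_1(W_RFᴴ) = ∫ Ṁ(θ)ᴴ W_RF W_RFᴴ Ṁ(θ) p_Θ(θ) dθ`. -/
def A₁ : Matrix (Fin NT) (Fin NT) ℂ :=
  Matrix.of fun i j =>
    ∫ θ, ((sys.Mdot θ)ᴴ * sys.WHᴴ * sys.WH * sys.Mdot θ) i j * (sys.pTheta θ : ℂ)

/-- `A_2(W_RFᴴ) = ∫ M(θ)ᴴ W_RF W_RFᴴ M(θ) p_Θ(θ) dθ`. -/
def A₂ : Matrix (Fin NT) (Fin NT) ℂ :=
  Matrix.of fun i j =>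
    ∫ θ, ((sys.M θ)ᴴ * sys.WHᴴ * sys.WH * sys.M θ) i j * (sys.pTheta θ : ℂ)

/-- The mean-squared error `E[(θ̂(y) - θ)²]` of an estimator `est` of `θ` that processes the
analog-combined observation `y` (the transmitted symbols `S` being known). -/
def mse {L : ℕ} (S : Matrix (Fin NS) (Fin L) ℂ) (est : (Fin L × Fin NRFR → ℂ) → ℝ) : ℝ≥0∞ :=
  ∫⁻ ζ, ∫⁻ y, ENNReal.ofReal ((est y - ζ 0) ^ 2) ∂(sys.obsLaw S ζ) ∂sys.prior

/-- The closed form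
`1 / (E_θ[(∂ ln p_Θ / ∂θ)²] + (2 N_{RF,R} L γ / (N_R σ_S²)) tr(A_1(W_RFᴴ) R))`
for a covariance matrix `R` of the transmitted signal. -/
def pcrbFormula (L : ℕ) (R : Matrix (Fin NT) (Fin NT) ℂ) : ℝ :=
  1 / (sys.priorInfoTheta +
    2 * NRFR * L * sys.gam / (NR * sys.noiseVar) * (sys.A₁ * R).trace.re)

end HybridSystem

end

/-!
The posterior Cramér-Rao bound for the angle, and why it has a closed form.

The rows of a partially-connected combiner have disjoint supports of equal size, so
`W_RFᴴ W_RF` is a multiple of the identity (`IsPartiallyConnected.mul_conjTranspose`) and the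
combined noise is white. Its law is found through characteristic functions
(`map_mulVec_whiteCSCG`), and the observation has a Gaussian density around the signal `u(ζ)`
(`HybridSystem.obsLaw_eq_withDensity`). The score is then the real-linear functional
`(2 / c) Re(∂_i uᴴ (y - u))` of white noise of variance `c`, and second moments of such functionals
give the Fisher information `(2 / c) Re(∂_i uᴴ ∂_j u)` (`HybridSystem.integral_score_mul_score`).

Under the prior `α` is centred and independent of `θ`, which removes the coupling between the angle
and `α` in the observation information; in the prior information it vanishes because `∫ p_Θ' = 0`. Hence
`[F⁻¹]₁₁ = 1 / F₁₁`, and `F₁₁` is computed by averaging a squared norm, which is a trace against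
`A₁`. Positive definiteness of `F` comes from the prior alone: a direction without information would
be one along which the integrable density `p_Z` is constant on almost every line
(`integral_eq_zero_of_fderiv_apply_ae_eq_zero`).

Because of the decoupling, the bound on the mean-squared error only needs the scalar inequality
`van_trees` for the angle, with `α` and `y` as nuisance variables. No boundary condition on the
prior is required: an integrable differentiable function with integrable derivative has a derivative
of zero integral, and the integrability needed follows from finite information and finite error.

For i.i.d. Gaussian symbols, the law of large numbers applied to `s_k conj(s_m)` gives the
convergence of the sample covariance. The ratio of the bounds tends to one because the
`L`-proportional parts dominate, unless the limiting trace is zero; in that case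
`W_RFᴴ Ṁ(θ) V_RF V_BB` vanishes for almost every `θ`, and the trace is zero for every block
(`HybridSystem.re_trace_mul_sampleCov_eq_zero`).
-/

noncomputable section

/-! ### Circularly symmetric complex Gaussian vectors -/

instance isProbabilityMeasure_cscg (v : ℝ≥0) : IsProbabilityMeasure (cscg v) := by
  unfold cscg
  exact Measure.isProbabilityMeasure_map
    (Complex.measurableEquivRealProd.symm.measurable.aemeasurable)

instance isProbabilityMeasure_whiteCSCG (ι : Type) [Fintype ι] (v : ℝ≥0) :
    IsProbabilityMeasure (whiteCSCG ι v) := by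
  unfold whiteCSCG; infer_instance

theorem integral_cexp_cscg (v : ℝ≥0) (c : ℂ) :
    ∫ z, Complex.exp (((star c * z).re : ℝ) * Complex.I) ∂(cscg v) =
      Complex.exp (-(v / 4 * ‖c‖ ^ 2 : ℝ)) := by
  have hm : Measurable (fun x : ℝ × ℝ => (⟨x.1, x.2⟩ : ℂ)) :=
    Complex.measurableEquivRealProd.symm.measurable
  unfold cscg
  rw [integral_map hm.aemeasurable (by fun_prop)]
  have h1 : ∀ x : ℝ × ℝ, Complex.exp (((star c * (⟨x.1, x.2⟩ : ℂ)).re : ℝ) * Complex.I) =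
      Complex.exp (c.re * x.1 * Complex.I) * Complex.exp (c.im * x.2 * Complex.I) := by
    intro x
    rw [← Complex.exp_add]
    congr 1
    simp [Complex.mul_re]
    ring
  simp_rw [h1]
  rw [integral_prod_mul (fun x : ℝ => Complex.exp (c.re * x * Complex.I))
    (fun x : ℝ => Complex.exp (c.im * x * Complex.I))]
  have h2 := charFun_gaussianReal (μ := 0) (v := v / 2)
  simp_rw [charFun_apply_real] at h2
  rw [h2, h2, ← Complex.exp_add]
  congr 1
  rw [← Complex.normSq_eq_norm_sq, Complex.normSq_apply]
  push_cast
  ring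

/-- The characteristic function of `CN(0, v I)`, at the real-linear functional `z ↦ Re (γᴴ z)`. -/
theorem integral_cexp_whiteCSCG (ι : Type) [Fintype ι] (v : ℝ≥0) (γ : ι → ℂ) :
    ∫ z, Complex.exp (((star γ ⬝ᵥ z).re : ℝ) * Complex.I) ∂(whiteCSCG ι v) =
      Complex.exp (-(v / 4 * ∑ k, ‖γ k‖ ^ 2 : ℝ)) := by
  have h1 : ∀ z : ι → ℂ, Complex.exp (((star γ ⬝ᵥ z).re : ℝ) * Complex.I) =
      ∏ k, Complex.exp (((star (γ k) * z k).re : ℝ) * Complex.I) := by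
    intro z
    rw [← Complex.exp_sum, ← Finset.sum_mul]
    simp [dotProduct, Complex.re_sum]
  simp_rw [h1]
  unfold whiteCSCG
  rw [integral_fintype_prod_eq_prod
    (fun k (z : ℂ) => Complex.exp (((star (γ k) * z).re : ℝ) * Complex.I))]
  simp_rw [integral_cexp_cscg]
  rw [← Complex.exp_sum]
  congr 1
  push_cast
  rw [Finset.sum_neg_distrib, Finset.mul_sum]

/-- Every real-linear functional on `ι → ℂ` is `z ↦ Re (γᴴ z)` for some `γ`. -/
theorem exists_re_star_dotProduct {ι : Type} [Fintype ι]
    (ℓ : StrongDual ℝ (ι → ℂ)) : ∃ γ : ι → ℂ, ∀ z, ℓ z = (star γ ⬝ᵥ z).re := by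
  classical
  refine ⟨fun k => ⟨ℓ (Pi.single k 1), ℓ (Pi.single k Complex.I)⟩, fun z => ?_⟩
  have hz : z = ∑ k, ((z k).re • (Pi.single k 1 : ι → ℂ) +
      (z k).im • (Pi.single k Complex.I : ι → ℂ)) := by
    ext j
    simp only [Finset.sum_apply, Pi.add_apply, Pi.smul_apply, Pi.single_apply]
    simp [Finset.sum_add_distrib, Complex.re_add_im]
  conv_lhs => rw [hz]
  simp only [map_sum, map_add, map_smul, dotProduct, Complex.re_sum]
  refine Finset.sum_congr rfl fun k _ => ?_
  simp [Complex.mul_re]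
  ring

/-- Finite measures on `ι → ℂ` with the same characteristic function are equal. -/
theorem ext_of_integral_cexp {ι : Type} [Fintype ι] {μ ν : Measure (ι → ℂ)}
    [IsFiniteMeasure μ] [IsFiniteMeasure ν]
    (h : ∀ γ : ι → ℂ, ∫ z, Complex.exp (((star γ ⬝ᵥ z).re : ℝ) * Complex.I) ∂μ =
      ∫ z, Complex.exp (((star γ ⬝ᵥ z).re : ℝ) * Complex.I) ∂ν) : μ = ν := by
  refine Measure.ext_of_charFunDual (funext fun ℓ => ?_)
  obtain ⟨γ, hγ⟩ := exists_re_star_dotProduct ℓ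
  simp_rw [charFunDual_apply, hγ]
  exact h γ

theorem sum_norm_sq_eq_re_star_dotProduct {ι : Type} [Fintype ι] (γ : ι → ℂ) :
    ∑ k, ‖γ k‖ ^ 2 = (star γ ⬝ᵥ γ).re := by
  simp only [dotProduct, Complex.re_sum]
  refine Finset.sum_congr rfl fun k _ => ?_
  rw [← Complex.normSq_eq_norm_sq, Complex.normSq_apply]
  simp [Complex.mul_re]

theorem measurable_re_star_dotProduct {ι : Type} [Fintype ι] (γ : ι → ℂ) :
    Measurable fun z : ι → ℂ => (star γ ⬝ᵥ z).re := by
  simp only [dotProduct]; fun_prop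

theorem measurable_mulVec {ι κ : Type} [Fintype κ] (A : Matrix ι κ ℂ) :
    Measurable fun n : κ → ℂ => A *ᵥ n := by
  refine measurable_pi_lambda _ fun i => ?_
  simp only [mulVec, dotProduct]; fun_prop

/-- White noise stays white under a combiner with orthogonal rows of equal norm. -/
theorem map_mulVec_whiteCSCG {ι κ : Type} [Fintype ι] [Fintype κ] [DecidableEq ι]
    (A : Matrix ι κ ℂ) (m v : ℝ≥0) (hA : A * Aᴴ = (m : ℂ) • 1) :
    (whiteCSCG κ v).map (fun n => A *ᵥ n) = whiteCSCG ι (m * v) := by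
  have hmeas := measurable_mulVec A
  have := Measure.isProbabilityMeasure_map (μ := whiteCSCG κ v) hmeas.aemeasurable
  refine ext_of_integral_cexp fun γ => ?_
  rw [integral_map hmeas.aemeasurable]
  · -- the combined noise sees the frequency `Aᴴ γ`, and `‖Aᴴ γ‖² = γᴴ A Aᴴ γ = m ‖γ‖²`
    have h1 : ∀ n, star γ ⬝ᵥ A *ᵥ n = star (Aᴴ *ᵥ γ) ⬝ᵥ n := by
      intro n
      rw [dotProduct_mulVec, star_mulVec, conjTranspose_conjTranspose]
    simp_rw [h1]
    rw [integral_cexp_whiteCSCG, integral_cexp_whiteCSCG, sum_norm_sq_eq_re_star_dotProduct,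
      sum_norm_sq_eq_re_star_dotProduct, ← h1, mulVec_mulVec, hA, smul_mulVec, one_mulVec,
      dotProduct_smul]
    congr 1
    simp
    ring
  · have := measurable_re_star_dotProduct γ
    exact Measurable.aestronglyMeasurable (by fun_prop)

/-- Stacking independent white vectors into the columns of a matrix gives a white vector. -/
theorem map_vec_pi_whiteCSCG {κ : Type} [Fintype κ] (L : ℕ) (v : ℝ≥0) :
    (Measure.pi fun _ : Fin L => whiteCSCG κ v).map
      (fun n => vec (Matrix.of fun i l => n l i)) = whiteCSCG (Fin L × κ) v := by
  have hmeas : Measurable (fun n : Fin L → κ → ℂ => vec (Matrix.of fun i l => n l i)) := by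
    refine measurable_pi_lambda _ fun i => ?_
    simp only [vec, of_apply]; fun_prop
  have := Measure.isProbabilityMeasure_map
    (μ := (Measure.pi fun _ : Fin L => whiteCSCG κ v)) hmeas.aemeasurable
  refine ext_of_integral_cexp fun γ => ?_
  rw [integral_map hmeas.aemeasurable]
  · have h1 : ∀ n : Fin L → κ → ℂ,
        Complex.exp (((star γ ⬝ᵥ vec (Matrix.of fun i l => n l i)).re : ℝ) * Complex.I) =
        ∏ l, Complex.exp (((star (fun i => γ (l, i)) ⬝ᵥ n l).re : ℝ) * Complex.I) := by
      intro n
      rw [← Complex.exp_sum, ← Finset.sum_mul]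
      simp [dotProduct, Complex.re_sum, vec, Fintype.sum_prod_type]
    simp_rw [h1]
    rw [integral_fintype_prod_eq_prod (fun l (z : κ → ℂ) =>
      Complex.exp (((star (fun i => γ (l, i)) ⬝ᵥ z).re : ℝ) * Complex.I))]
    simp_rw [integral_cexp_whiteCSCG]
    rw [← Complex.exp_sum, Fintype.sum_prod_type]
    congr 1
    push_cast
    rw [Finset.sum_neg_distrib, Finset.mul_sum]
  · have := measurable_re_star_dotProduct γ
    exact Measurable.aestronglyMeasurable (by fun_prop)

/-- A product of laws with densities has the product density. -/
theorem pi_withDensity_ofReal {ι : Type} [Fintype ι] {E : Type} [MeasurableSpace E]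
    (μ : Measure E) [SigmaFinite μ] (f : E → ℝ) (hf : Integrable f μ) (hf0 : ∀ x, 0 ≤ f x) :
    Measure.pi (fun _ : ι => μ.withDensity fun x => ENNReal.ofReal (f x)) =
      (Measure.pi fun _ : ι => μ).withDensity fun x => ENNReal.ofReal (∏ k, f (x k)) := by
  have hfin : IsFiniteMeasure (μ.withDensity fun x => ENNReal.ofReal (f x)) :=
    isFiniteMeasure_withDensity_ofReal hf.2
  refine Measure.pi_eq fun s hs => ?_
  rw [withDensity_apply _ (MeasurableSet.univ_pi hs), Measure.restrict_pi_pi,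
    ← ofReal_integral_eq_lintegral_ofReal, integral_fintype_prod_eq_prod (fun _ => f),
    ENNReal.ofReal_prod_of_nonneg]
  · refine Finset.prod_congr rfl fun k _ => ?_
    rw [withDensity_apply _ (hs k), ofReal_integral_eq_lintegral_ofReal hf.integrableOn]
    exact .of_forall hf0
  · exact fun k _ => integral_nonneg hf0
  · exact Integrable.fintype_prod (f := fun _ => f) fun k => hf.integrableOn
  · exact .of_forall fun x => Finset.prod_nonneg fun k _ => hf0 _

theorem cscg_eq_withDensity {v : ℝ≥0} (hv : v ≠ 0) :
    cscg v = volume.withDensity fun z : ℂ =>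
      ENNReal.ofReal (Real.exp (-(‖z‖ ^ 2 / v)) / (Real.pi * v)) := by
  have hv2 : v / 2 ≠ 0 := by positivity
  have hv' : (v : ℝ) ≠ 0 := by exact_mod_cast hv
  have hmp := Complex.volume_preserving_equiv_real_prod.symm
  unfold cscg
  rw [gaussianReal_of_var_ne_zero _ hv2,
    prod_withDensity (measurable_gaussianPDF _ _) (measurable_gaussianPDF _ _)]
  change Measure.map Complex.measurableEquivRealProd.symm (Measure.withDensity volume _) = _
  ext s hs
  rw [MeasurableEquiv.map_apply, withDensity_apply _ (MeasurableEquiv.measurable _ hs),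
    withDensity_apply _ hs, ← hmp.setLIntegral_comp_preimage hs (by fun_prop)]
  refine setLIntegral_congr_fun (MeasurableEquiv.measurable _ hs) fun x _ => ?_
  simp only [gaussianPDF, gaussianPDFReal]
  rw [← ENNReal.ofReal_mul (by positivity)]
  congr 1
  have h3 : ‖Complex.measurableEquivRealProd.symm x‖ ^ 2 = x.1 ^ 2 + x.2 ^ 2 := by
    rw [← Complex.normSq_eq_norm_sq, Complex.normSq_apply]
    simp [Complex.measurableEquivRealProd]
    ring
  rw [h3, mul_mul_mul_comm, ← Real.exp_add, ← mul_inv]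
  have h4 : √(2 * Real.pi * ((v / 2 : ℝ≥0) : ℝ)) * √(2 * Real.pi * ((v / 2 : ℝ≥0) : ℝ)) =
      Real.pi * v := by
    rw [Real.mul_self_sqrt (by positivity)]; push_cast; ring
  rw [h4, inv_mul_eq_div]
  congr 2
  push_cast
  field_simp
  ring

theorem whiteCSCG_eq_withDensity (ι : Type) [Fintype ι] {v : ℝ≥0} (hv : v ≠ 0) :
    whiteCSCG ι v = volume.withDensity fun z : ι → ℂ =>
      ENNReal.ofReal (Real.exp (-((∑ k, ‖z k‖ ^ 2) / v)) / (Real.pi * v) ^ Fintype.card ι) := by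
  -- the scalar density is integrable because it is the density of a probability measure
  have hint : Integrable fun z : ℂ => Real.exp (-(‖z‖ ^ 2 / v)) / (Real.pi * v) := by
    have h1 : IsProbabilityMeasure (cscg v) := inferInstance
    rw [cscg_eq_withDensity hv] at h1
    refine ⟨Measurable.aestronglyMeasurable (by fun_prop), ?_⟩
    rw [hasFiniteIntegral_iff_ofReal (.of_forall fun z => by positivity)]
    have := h1.measure_univ
    rw [withDensity_apply _ MeasurableSet.univ, setLIntegral_univ] at this
    rw [this]; simp
  unfold whiteCSCG
  rw [cscg_eq_withDensity hv, pi_withDensity_ofReal _ _ hint fun z => by positivity,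
    ← volume_pi]
  congr 1
  ext z
  rw [Finset.prod_div_distrib, ← Real.exp_sum, Finset.sum_neg_distrib, Finset.sum_div]
  simp

theorem map_re_star_dotProduct_whiteCSCG {ι : Type} [Fintype ι] (v : ℝ≥0) (γ : ι → ℂ) :
    (whiteCSCG ι v).map (fun z => (star γ ⬝ᵥ z).re) =
      gaussianReal 0 (v / 2 * ∑ k, ‖γ k‖₊ ^ 2) := by
  have hm := measurable_re_star_dotProduct γ
  have := Measure.isProbabilityMeasure_map (μ := whiteCSCG ι v) hm.aemeasurable
  refine Measure.ext_of_charFun (funext fun t => ?_)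
  rw [charFun_apply_real, charFun_gaussianReal, integral_map hm.aemeasurable (by fun_prop)]
  have h1 : ∀ z : ι → ℂ, (t : ℂ) * ((star γ ⬝ᵥ z).re : ℝ) = ((star (t • γ) ⬝ᵥ z).re : ℝ) := by
    intro z
    rw [star_smul, smul_dotProduct]
    simp
  simp_rw [h1, integral_cexp_whiteCSCG]
  congr 1
  simp only [Pi.smul_apply, norm_smul, mul_pow, ← Finset.mul_sum]
  simp
  ring

theorem integral_re_star_dotProduct_whiteCSCG {ι : Type} [Fintype ι] (v : ℝ≥0) (γ : ι → ℂ) :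
    ∫ z, (star γ ⬝ᵥ z).re ∂(whiteCSCG ι v) = 0 := by
  have hm := measurable_re_star_dotProduct γ
  have := integral_map (f := fun x : ℝ => x) (hm.aemeasurable (μ := whiteCSCG ι v)) (by fun_prop)
  rw [← this, map_re_star_dotProduct_whiteCSCG, integral_id_gaussianReal]

theorem memLp_re_star_dotProduct_whiteCSCG {ι : Type} [Fintype ι] (v : ℝ≥0) (γ : ι → ℂ) :
    MemLp (fun z => (star γ ⬝ᵥ z).re) 2 (whiteCSCG ι v) := by
  have hm := measurable_re_star_dotProduct γ
  have h := memLp_id_gaussianReal' (μ := 0) (v := v / 2 * ∑ k, ‖γ k‖₊ ^ 2) 2 (by simp)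
  rw [← map_re_star_dotProduct_whiteCSCG, memLp_map_measure_iff (by fun_prop) hm.aemeasurable] at h
  exact h

theorem integral_re_star_dotProduct_sq_whiteCSCG {ι : Type} [Fintype ι] (v : ℝ≥0) (γ : ι → ℂ) :
    ∫ z, (star γ ⬝ᵥ z).re ^ 2 ∂(whiteCSCG ι v) = v / 2 * (star γ ⬝ᵥ γ).re := by
  have hm := measurable_re_star_dotProduct γ
  have := integral_map (f := fun x : ℝ => x ^ 2) (hm.aemeasurable (μ := whiteCSCG ι v))
    (by fun_prop)
  have hv := variance_fun_id_gaussianReal (μ := 0) (v := v / 2 * ∑ k, ‖γ k‖₊ ^ 2)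
  rw [variance_eq_integral (by fun_prop), integral_id_gaussianReal] at hv
  simp only [sub_zero] at hv
  rw [← this, map_re_star_dotProduct_whiteCSCG, hv, ← sum_norm_sq_eq_re_star_dotProduct]
  simp

/-- The covariance of two real-linear functionals of white noise, from their variances by
polarization. -/
theorem integral_re_star_dotProduct_mul_whiteCSCG {ι : Type} [Fintype ι] (v : ℝ≥0)
    (γ δ : ι → ℂ) :
    ∫ z, (star γ ⬝ᵥ z).re * (star δ ⬝ᵥ z).re ∂(whiteCSCG ι v) =
      v / 2 * (star γ ⬝ᵥ δ).re := by
  have h1 : ∀ z : ι → ℂ, (star γ ⬝ᵥ z).re * (star δ ⬝ᵥ z).re =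
      ((star (γ + δ) ⬝ᵥ z).re ^ 2 - (star (γ - δ) ⬝ᵥ z).re ^ 2) / 4 := by
    intro z
    simp only [star_add, star_sub, add_dotProduct, sub_dotProduct, Complex.add_re, Complex.sub_re]
    ring
  have hsymm : (star δ ⬝ᵥ γ).re = (star γ ⬝ᵥ δ).re := by
    rw [star_dotProduct, Complex.star_def, Complex.conj_re]
  simp_rw [h1]
  rw [integral_div, integral_sub (memLp_re_star_dotProduct_whiteCSCG v _).integrable_sq
    (memLp_re_star_dotProduct_whiteCSCG v _).integrable_sq,
    integral_re_star_dotProduct_sq_whiteCSCG, integral_re_star_dotProduct_sq_whiteCSCG]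
  simp only [star_add, star_sub, add_dotProduct, sub_dotProduct, dotProduct_add, dotProduct_sub,
    Complex.add_re, Complex.sub_re, hsymm]
  ring

/-! ### Information inequalities for densities -/

/-- By Fubini, almost every line in the direction `v` meets the exceptional set in a null set, and a
differentiable function with almost everywhere vanishing derivative is constant on such a line. -/
theorem ae_forall_translate_eq {E : Type*} [NormedAddCommGroup E] [NormedSpace ℝ E]
    [FiniteDimensional ℝ E] [MeasurableSpace E] [BorelSpace E] (μ : Measure E)
    [μ.IsAddHaarMeasure] {p : E → ℝ} (hp : Differentiable ℝ p) {v : E}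
    (h : ∀ᵐ x ∂μ, fderiv ℝ p x v = 0) : ∀ᵐ x ∂μ, ∀ t : ℝ, p (x + t • v) = p x := by
  have hmeas : MeasurableSet {q : E × ℝ | fderiv ℝ p (q.1 + q.2 • v) v = 0} := by
    have h1 : Measurable fun x => fderiv ℝ p x v := measurable_fderiv_apply_const ℝ p v
    have h2 : Measurable fun q : E × ℝ => q.1 + q.2 • v :=
      Continuous.measurable (by fun_prop)
    exact (h1.comp h2) (measurableSet_singleton 0)
  have h1 : ∀ᵐ t : ℝ, ∀ᵐ x ∂μ, fderiv ℝ p (x + t • v) v = 0 := .of_forall fun t =>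
    (measurePreserving_add_right μ (t • v)).quasiMeasurePreserving.ae h
  have h2 : ∀ᵐ x ∂μ, ∀ᵐ t : ℝ, fderiv ℝ p (x + t • v) v = 0 :=
    (Measure.ae_ae_comm hmeas).2 h1
  filter_upwards [h2] with x hx t
  have hd : ∀ s : ℝ, HasDerivAt (fun s : ℝ => p (x + s • v)) (fderiv ℝ p (x + s • v) v) s := by
    intro s
    have hl : HasDerivAt (fun s : ℝ => x + s • v) v s := by
      simpa using ((hasDerivAt_id s).smul_const v).const_add x
    exact (hp (x + s • v)).hasFDerivAt.comp_hasDerivAt s hl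
  have hi : IntervalIntegrable (fun s => fderiv ℝ p (x + s • v) v) volume 0 t := by
    refine (intervalIntegrable_const (c := (0 : ℝ))).congr_ae ?_
    exact ae_restrict_of_ae (hx.mono fun s hs => hs.symm)
  have := intervalIntegral.integral_eq_sub_of_hasDerivAt (fun s _ => hd s) hi
  rw [intervalIntegral.integral_congr_ae (g := fun _ => 0) (hx.mono fun s hs _ => hs)] at this
  simp only [intervalIntegral.integral_zero, zero_smul, add_zero] at this
  linarith

/-- An integrable function whose derivative in a fixed direction vanishes almost everywhere is
invariant under the translations in that direction, so that its mass in a ball escapes to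
infinity. -/
theorem integral_eq_zero_of_fderiv_apply_ae_eq_zero {E : Type*} [NormedAddCommGroup E]
    [NormedSpace ℝ E] [FiniteDimensional ℝ E] [MeasurableSpace E] [BorelSpace E] (μ : Measure E)
    [μ.IsAddHaarMeasure] {p : E → ℝ} (hp : Differentiable ℝ p) (hint : Integrable p μ) {v : E}
    (hv : v ≠ 0) (h : ∀ᵐ x ∂μ, fderiv ℝ p x v = 0) : ∫ x, p x ∂μ = 0 := by
  have hinv := ae_forall_translate_eq μ hp h
  have hball : ∀ k : ℕ, ∫ x in Metric.ball (0 : E) k, p x ∂μ = 0 := by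
    intro k
    set B := Metric.ball (0 : E) k
    have hB : MeasurableSet B := measurableSet_ball
    -- the mass of the ball shifted by `n • v` does not depend on `n`
    have hshift : ∀ n : ℕ, ∫ y, B.indicator (fun _ => (1 : ℝ)) (y - (n : ℝ) • v) * p y ∂μ =
        ∫ x in B, p x ∂μ := by
      intro n
      rw [← integral_add_right_eq_self _ ((n : ℝ) • v), ← integral_indicator hB]
      refine integral_congr_ae ?_
      filter_upwards [hinv] with x hx
      rw [add_sub_cancel_right, hx]
      by_cases hxB : x ∈ B <;> simp [hxB]
    -- and it tends to zero, since every point is eventually outside the shifted ball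
    have hlim : Tendsto (fun n : ℕ =>
        ∫ y, B.indicator (fun _ => (1 : ℝ)) (y - (n : ℝ) • v) * p y ∂μ) atTop
        (𝓝 (∫ _, (0 : ℝ) ∂μ)) := by
      refine tendsto_integral_of_dominated_convergence (fun y => ‖p y‖) (fun n => ?_) hint.norm
        (fun n => .of_forall fun y => ?_) (.of_forall fun y => ?_)
      · refine AEStronglyMeasurable.mul ?_ hint.1
        have : Measurable fun y : E => B.indicator (fun _ => (1 : ℝ)) (y - (n : ℝ) • v) :=
          (measurable_const.indicator hB).comp (measurable_sub_const _)
        exact this.aestronglyMeasurable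
      · rw [norm_mul]
        refine mul_le_of_le_one_left (norm_nonneg _) ?_
        by_cases hy : y - (n : ℝ) • v ∈ B <;> simp [hy]
      · refine tendsto_const_nhds.congr' ?_
        obtain ⟨N, hN⟩ := exists_nat_gt ((k + ‖y‖) / ‖v‖)
        filter_upwards [eventually_ge_atTop N] with n hn
        have hy : y - (n : ℝ) • v ∉ B := by
          intro hy
          rw [mem_ball_zero_iff] at hy
          have h1 : ‖(n : ℝ) • v‖ ≤ ‖y‖ + ‖y - (n : ℝ) • v‖ := by
            have := norm_sub_le y (y - (n : ℝ) • v)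
            simpa using this
          rw [norm_smul, Real.norm_natCast] at h1
          rw [div_lt_iff₀ (norm_pos_iff.2 hv)] at hN
          have h2 : (N : ℝ) * ‖v‖ ≤ n * ‖v‖ :=
            mul_le_mul_of_nonneg_right (by exact_mod_cast hn) (norm_nonneg _)
          linarith
        simp [hy]
    simp_rw [hshift] at hlim
    simpa using tendsto_nhds_unique tendsto_const_nhds hlim
  have hc := (aecover_ball (μ := μ) (x := (0 : E)) (r := fun k : ℕ => (k : ℝ))
    tendsto_natCast_atTop_atTop).integral_tendsto_of_countably_generated hint
  simp_rw [hball] at hc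
  exact (tendsto_nhds_unique tendsto_const_nhds hc).symm

/-- The Bayesian information inequality. Here `f` is the joint density of a real parameter `θ` and
of everything else `w`, `ψ` is its score with respect to `θ`, and `T` estimates `θ` from `w`.
Integration by parts along each line of constant `w` gives `E[(T - θ) ψ] = 1`, and the
Cauchy-Schwarz inequality concludes. -/
theorem van_trees {W : Type*} [MeasurableSpace W] (ν : Measure W) [SFinite ν]
    {f ψ : ℝ × W → ℝ} (hf : Measurable f) (hψ : Measurable ψ) (hf0 : ∀ x, 0 ≤ f x)
    (hderiv : ∀ w θ, HasDerivAt (fun t => f (t, w)) (ψ (θ, w) * f (θ, w)) θ)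
    (hf1 : ∫⁻ x, ENNReal.ofReal (f x) ∂(volume.prod ν) = 1)
    {T : W → ℝ} (hT : Measurable T) {J : ℝ} (hJ : 0 ≤ J)
    (hinfo : ∫⁻ x, ENNReal.ofReal (ψ x ^ 2 * f x) ∂(volume.prod ν) ≤ ENNReal.ofReal J)
    (hmse : ∫⁻ x, ENNReal.ofReal ((T x.2 - x.1) ^ 2 * f x) ∂(volume.prod ν) ≠ ∞) :
    1 ≤ ENNReal.ofReal J *
      ∫⁻ x, ENNReal.ofReal ((T x.2 - x.1) ^ 2 * f x) ∂(volume.prod ν) := by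
  set μ := (volume : Measure ℝ).prod ν
  have key : ∀ g : ℝ × W → ℝ, Measurable g → (∀ x, 0 ≤ g x) →
      ∫⁻ x, ENNReal.ofReal (g x) ∂μ ≠ ∞ → Integrable g μ := by
    intro g hg hg0 h
    refine ⟨hg.aestronglyMeasurable, ?_⟩
    rw [hasFiniteIntegral_iff_ofReal (.of_forall hg0)]
    exact h.lt_top
  have hT' : Measurable fun x : ℝ × W => T x.2 - x.1 := by fun_prop
  have If : Integrable f μ := key f hf hf0 (by rw [hf1]; simp)
  have Iψ : Integrable (fun x => ψ x ^ 2 * f x) μ :=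
    key _ (by fun_prop) (fun x => mul_nonneg (sq_nonneg _) (hf0 x))
      (ne_top_of_le_ne_top ENNReal.ofReal_ne_top hinfo)
  have Ie : Integrable (fun x => (T x.2 - x.1) ^ 2 * f x) μ :=
    key _ (by fun_prop) (fun x => mul_nonneg (sq_nonneg _) (hf0 x)) hmse
  have Ieψ : Integrable (fun x => (T x.2 - x.1) * (ψ x * f x)) μ := by
    refine (Ie.add Iψ).mono' (Measurable.aestronglyMeasurable (by fun_prop))
      (.of_forall fun x => ?_)
    rw [Real.norm_eq_abs, Pi.add_apply, abs_le]
    constructor <;> nlinarith [mul_nonneg (sq_nonneg (T x.2 - x.1 + ψ x)) (hf0 x),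
      mul_nonneg (sq_nonneg (T x.2 - x.1 - ψ x)) (hf0 x),
      mul_nonneg (sq_nonneg (T x.2 - x.1)) (hf0 x), mul_nonneg (sq_nonneg (ψ x)) (hf0 x)]
  have Ief : Integrable (fun x => (T x.2 - x.1) * f x) μ := by
    refine (Ie.add If).mono' (Measurable.aestronglyMeasurable (by fun_prop))
      (.of_forall fun x => ?_)
    rw [Real.norm_eq_abs, Pi.add_apply, abs_le]
    constructor <;> nlinarith [mul_nonneg (sq_nonneg (T x.2 - x.1 + 1)) (hf0 x),
      mul_nonneg (sq_nonneg (T x.2 - x.1 - 1)) (hf0 x),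
      mul_nonneg (sq_nonneg (T x.2 - x.1)) (hf0 x), hf0 x]
  have hf1' : ∫ x, f x ∂μ = 1 := by
    rw [integral_eq_lintegral_of_nonneg_ae (.of_forall hf0) hf.aestronglyMeasurable, hf1]; simp
  -- integration by parts on the line of constant `w`, where `(T w - θ) f` and its derivative are
  -- integrable, so that there are no boundary terms
  have hcross : ∫ x, (T x.2 - x.1) * (ψ x * f x) ∂μ = 1 := by
    rw [← hf1', integral_prod_symm _ Ieψ, integral_prod_symm _ If]
    refine integral_congr_ae ?_
    filter_upwards [Ieψ.prod_left_ae, If.prod_left_ae, Ief.prod_left_ae] with w h1 h2 h3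
    have hd : ∀ θ, HasDerivAt (fun t => (T w - t) * f (t, w))
        ((T w - θ) * (ψ (θ, w) * f (θ, w)) - f (θ, w)) θ := by
      intro θ
      have := ((hasDerivAt_id θ).const_sub (T w)).mul (hderiv w θ)
      exact this.congr_deriv (by simp only [id]; ring)
    have := integral_eq_zero_of_hasDerivAt_of_integrable hd (h1.sub h2) h3
    rw [integral_sub h1 h2] at this
    linarith
  set A := ∫ x, (T x.2 - x.1) ^ 2 * f x ∂μ with hA
  set K := ∫ x, ψ x ^ 2 * f x ∂μ with hK
  -- `E[(s (T - θ) - ψ)²]` as a quadratic polynomial in `s`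
  have hquad : ∀ s : ℝ, 0 ≤ A * (s * s) + (-2) * s + K := by
    intro s
    have h0 : 0 ≤ ∫ x, (s ^ 2 * ((T x.2 - x.1) ^ 2 * f x)
        - 2 * s * ((T x.2 - x.1) * (ψ x * f x)) + ψ x ^ 2 * f x) ∂μ := by
      refine integral_nonneg fun x => ?_
      have := mul_nonneg (sq_nonneg (s * (T x.2 - x.1) - ψ x)) (hf0 x)
      simp only [Pi.zero_apply]
      linarith
    have hsub : Integrable (fun x => s ^ 2 * ((T x.2 - x.1) ^ 2 * f x)
        - 2 * s * ((T x.2 - x.1) * (ψ x * f x))) μ := (Ie.const_mul _).sub (Ieψ.const_mul _)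
    rw [integral_add hsub Iψ, integral_sub (Ie.const_mul _) (Ieψ.const_mul _),
      integral_const_mul, integral_const_mul, hcross] at h0
    linarith
  have hd := discrim_le_zero hquad
  rw [discrim] at hd
  have hA0 : 0 ≤ A := integral_nonneg fun x => mul_nonneg (sq_nonneg _) (hf0 x)
  have hAl : ∫⁻ x, ENNReal.ofReal ((T x.2 - x.1) ^ 2 * f x) ∂μ = ENNReal.ofReal A :=
    (ofReal_integral_eq_lintegral_ofReal Ie
      (.of_forall fun x => mul_nonneg (sq_nonneg _) (hf0 x))).symm
  have hKJ : K ≤ J := by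
    rw [← ENNReal.ofReal_le_ofReal_iff hJ, hK, ofReal_integral_eq_lintegral_ofReal Iψ
      (.of_forall fun x => mul_nonneg (sq_nonneg _) (hf0 x))]
    exact hinfo
  rw [hAl, ← ENNReal.ofReal_mul hJ, ← ENNReal.ofReal_one]
  apply ENNReal.ofReal_le_ofReal
  nlinarith [mul_le_mul_of_nonneg_left hKJ hA0]

/-! ### The combined noise and the observation law -/

/-- The rows of the combiner have disjoint supports of `N_R / N_{RF,R}` unit-modulus entries. -/
theorem IsPartiallyConnected.mul_conjTranspose {NR NRFR : ℕ} {WH : Matrix (Fin NRFR) (Fin NR) ℂ}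
    (hdvd : NRFR ∣ NR) (hWH : IsPartiallyConnected WH) :
    WH * WHᴴ = ((NR / NRFR : ℕ) : ℂ) • 1 := by
  set m := NR / NRFR with hm
  have hNR : NRFR * m = NR := Nat.mul_div_cancel' hdvd
  ext i k
  rw [Matrix.mul_apply, Matrix.smul_apply, Matrix.one_apply]
  simp only [conjTranspose_apply]
  split_ifs with hik
  · subst hik
    have h1 : ∀ j : Fin NR, WH i j * star (WH i j) =
        ((if (i : ℕ) * m ≤ (j : ℕ) ∧ (j : ℕ) < ((i : ℕ) + 1) * m then 1 else 0 : ℕ) : ℂ) := by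
      intro j
      rw [Complex.star_def, Complex.mul_conj, Complex.normSq_eq_norm_sq, hWH i j]
      split_ifs <;> simp
    simp_rw [h1]
    rw [← Nat.cast_sum, Fin.sum_univ_eq_sum_range
      (fun j => if (i : ℕ) * m ≤ j ∧ j < ((i : ℕ) + 1) * m then 1 else 0) NR,
      Finset.sum_boole, smul_eq_mul, mul_one]
    have h2 : (Finset.range NR).filter (fun j => (i : ℕ) * m ≤ j ∧ j < ((i : ℕ) + 1) * m) =
        Finset.Ico ((i : ℕ) * m) (((i : ℕ) + 1) * m) := by
      ext j
      simp only [Finset.mem_filter, Finset.mem_range, Finset.mem_Ico, and_iff_right_iff_imp]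
      rintro ⟨-, h⟩
      have : ((i : ℕ) + 1) * m ≤ NRFR * m := Nat.mul_le_mul_right m i.2
      omega
    rw [h2, Nat.card_Ico]
    simp [Nat.add_mul]
  · rw [smul_zero]
    refine Finset.sum_eq_zero fun j _ => ?_
    by_contra hne
    have hi : WH i j ≠ 0 := left_ne_zero_of_mul hne
    have hk : WH k j ≠ 0 := by
      intro h0; apply hne; simp [h0]
    have block : ∀ r : Fin NRFR, WH r j ≠ 0 →
        (r : ℕ) * m ≤ (j : ℕ) ∧ (j : ℕ) < ((r : ℕ) + 1) * m := by
      intro r hr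
      by_contra hcon
      have := hWH r j
      rw [if_neg hcon] at this
      exact hr (norm_eq_zero.1 this)
    obtain ⟨hi1, hi2⟩ := block i hi
    obtain ⟨hk1, hk2⟩ := block k hk
    apply hik
    have e1 : (i : ℕ) < (k : ℕ) + 1 := lt_of_mul_lt_mul_right (hi1.trans_lt hk2) (Nat.zero_le m)
    have e2 : (k : ℕ) < (i : ℕ) + 1 := lt_of_mul_lt_mul_right (hk1.trans_lt hi2) (Nat.zero_le m)
    exact Fin.ext (by omega)

theorem map_const_add_withDensity {E : Type*} [AddGroup E] [MeasurableSpace E]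
    [MeasurableAdd₂ E] [MeasurableSub E] (μ : Measure E) [μ.IsAddLeftInvariant]
    (f : E → ℝ≥0∞) (u : E) :
    (μ.withDensity f).map (fun x => u + x) = μ.withDensity fun y => f (-u + y) := by
  ext s hs
  have hm : Measurable fun x => u + x := measurable_const_add u
  rw [Measure.map_apply hm hs, withDensity_apply _ (hm hs), withDensity_apply _ hs,
    ← lintegral_indicator hs, ← lintegral_indicator (hm hs),
    ← lintegral_add_left_eq_self (s.indicator fun y => f (-u + y)) u]
  refine lintegral_congr fun x => ?_
  by_cases hx : u + x ∈ s <;> simp [hx]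

namespace HybridSystem

variable {NT NR NRFT NRFR NS : ℕ} (sys : HybridSystem NT NR NRFT NRFR NS)

/-- The variance `(N_R / N_{RF,R}) σ_S²` of each coordinate of the combined noise. -/
def combVar : ℝ := (NR : ℝ) / NRFR * sys.noiseVar

theorem natCast_div_pos (hNR : 0 < NR) (hdvd : NRFR ∣ NR) : 0 < (NR : ℝ) / NRFR := by
  have : 0 < NRFR := Nat.pos_of_dvd_of_pos hdvd hNR
  positivity

theorem combVar_pos (hNR : 0 < NR) (hdvd : NRFR ∣ NR) (hσ : 0 < sys.noiseVar) :
    0 < sys.combVar :=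
  mul_pos (natCast_div_pos hNR hdvd) hσ

theorem kronecker_mul_conjTranspose (hdvd : NRFR ∣ NR) (hWH : IsPartiallyConnected sys.WH)
    (L : ℕ) :
    ((1 : Matrix (Fin L) (Fin L) ℂ) ⊗ₖ sys.WH) * ((1 : Matrix (Fin L) (Fin L) ℂ) ⊗ₖ sys.WH)ᴴ =
      ((NR / NRFR : ℕ) : ℂ) • 1 := by
  rw [conjTranspose_kronecker, ← mul_kronecker_mul, hWH.mul_conjTranspose hdvd, conjTranspose_one,
    mul_one, kronecker_smul, one_kronecker_one]

theorem noiseCov_eq (hNR : 0 < NR) (hdvd : NRFR ∣ NR) (hWH : IsPartiallyConnected sys.WH)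
    (L : ℕ) : sys.noiseCov L = (sys.combVar : ℂ) • 1 := by
  have : (NRFR : ℂ) ≠ 0 := by exact_mod_cast (Nat.pos_of_dvd_of_pos hdvd hNR).ne'
  rw [noiseCov, sys.kronecker_mul_conjTranspose hdvd hWH, smul_smul, combVar,
    Nat.cast_div hdvd this]
  push_cast
  rw [mul_comm]

/-- Given the parameter, the observation is the signal plus white noise of variance `combVar`. -/
theorem obsLaw_eq_map (hdvd : NRFR ∣ NR) (hWH : IsPartiallyConnected sys.WH)
    (hσ : 0 < sys.noiseVar) {L : ℕ} (S : Matrix (Fin NS) (Fin L) ℂ) (ζ : Fin 3 → ℝ) :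
    sys.obsLaw S ζ = (whiteCSCG (Fin L × Fin NRFR) sys.combVar.toNNReal).map
      (fun n => sys.signal S ζ + n) := by
  have h1 : sys.combVar.toNNReal = ((NR / NRFR : ℕ) : ℝ≥0) * sys.noiseVar.toNNReal := by
    by_cases h0 : NRFR = 0
    · subst h0; simp [combVar]
    rw [combVar, Real.toNNReal_mul (by positivity), Nat.cast_div hdvd (by exact_mod_cast h0),
      Real.toNNReal_div (by positivity)]
    simp
  have hA : Measurable fun n : Fin L → Fin NR → ℂ => vec (Matrix.of fun i l => n l i) := by
    refine measurable_pi_lambda _ fun i => ?_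
    simp only [vec, of_apply]; fun_prop
  have hB := measurable_mulVec ((1 : Matrix (Fin L) (Fin L) ℂ) ⊗ₖ sys.WH)
  rw [h1, ← map_mulVec_whiteCSCG ((1 : Matrix (Fin L) (Fin L) ℂ) ⊗ₖ sys.WH) _ _
    (by rw [sys.kronecker_mul_conjTranspose hdvd hWH]; simp), ← map_vec_pi_whiteCSCG,
    Measure.map_map hB hA, Measure.map_map (measurable_const_add _) (hB.comp hA), obsLaw]
  congr 1
  funext n
  simp only [Function.comp, vec_mul_eq_mulVec]

theorem noiseCov_inv (hNR : 0 < NR) (hdvd : NRFR ∣ NR) (hWH : IsPartiallyConnected sys.WH)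
    (hσ : 0 < sys.noiseVar) (L : ℕ) :
    (sys.noiseCov L)⁻¹ = ((sys.combVar⁻¹ : ℝ) : ℂ) • 1 := by
  have hc' : (sys.combVar : ℂ) ≠ 0 := by exact_mod_cast (sys.combVar_pos hNR hdvd hσ).ne'
  rw [sys.noiseCov_eq hNR hdvd hWH]
  apply inv_eq_right_inv
  rw [smul_mul_smul_comm, mul_one]
  push_cast
  rw [mul_inv_cancel₀ hc', one_smul]

/-- The likelihood with the white noise covariance inserted. -/
theorem likelihood_eq (hNR : 0 < NR) (hdvd : NRFR ∣ NR) (hWH : IsPartiallyConnected sys.WH)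
    (hσ : 0 < sys.noiseVar) {L : ℕ} (S : Matrix (Fin NS) (Fin L) ℂ) (ζ : Fin 3 → ℝ)
    (y : Fin L × Fin NRFR → ℂ) :
    sys.likelihood S ζ y = Real.exp (-((∑ k, ‖y k - sys.signal S ζ k‖ ^ 2) / sys.combVar)) /
      (Real.pi * sys.combVar) ^ Fintype.card (Fin L × Fin NRFR) := by
  have hc := sys.combVar_pos hNR hdvd hσ
  rw [likelihood, cscgPDF, sys.noiseCov_inv hNR hdvd hWH hσ, sys.noiseCov_eq hNR hdvd hWH,
    det_smul, det_one, mul_one,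
    ← Complex.ofReal_pow, Complex.ofReal_re, smul_mulVec, one_mulVec, dotProduct_smul,
    smul_eq_mul, Complex.re_ofReal_mul, ← sum_norm_sq_eq_re_star_dotProduct, mul_pow]
  simp only [Pi.sub_apply]
  congr 2
  ring

theorem obsLaw_eq_withDensity (hNR : 0 < NR) (hdvd : NRFR ∣ NR)
    (hWH : IsPartiallyConnected sys.WH) (hσ : 0 < sys.noiseVar) {L : ℕ}
    (S : Matrix (Fin NS) (Fin L) ℂ) (ζ : Fin 3 → ℝ) :
    sys.obsLaw S ζ = volume.withDensity fun y => ENNReal.ofReal (sys.likelihood S ζ y) := by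
  have hc := sys.combVar_pos hNR hdvd hσ
  rw [sys.obsLaw_eq_map hdvd hWH hσ, whiteCSCG_eq_withDensity _ (by simpa using hc),
    map_const_add_withDensity]
  congr 1
  funext y
  rw [sys.likelihood_eq hNR hdvd hWH hσ]
  simp only [Real.coe_toNNReal _ hc.le, Pi.add_apply, Pi.neg_apply, neg_add_eq_sub]

end HybridSystem

/-! ### The score of the observation -/

theorem hasDerivAt_exp_neg_sum_norm_sq {ι : Type} [Fintype ι] {u : ℝ → ι → ℂ} {u' : ι → ℂ}
    {t : ℝ} (hu : HasDerivAt u u' t) (y : ι → ℂ) (c K : ℝ) :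
    HasDerivAt (fun s => Real.exp (-((∑ k, ‖y k - u s k‖ ^ 2) / c)) / K)
      (2 / c * (star u' ⬝ᵥ (y - u t)).re *
        (Real.exp (-((∑ k, ‖y k - u t k‖ ^ 2) / c)) / K)) t := by
  have h1 : ∀ k, HasDerivAt (fun s => ‖y k - u s k‖ ^ 2)
      (2 * inner ℝ (y k - u t k) (-u' k)) t := fun k =>
    ((hasDerivAt_pi.1 hu k).const_sub (y k)).norm_sq
  have h2 := ((HasDerivAt.fun_sum fun k (_ : k ∈ Finset.univ) => h1 k).div_const
    c).neg.exp.div_const K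
  refine h2.congr_deriv ?_
  have h3 : ∑ k, 2 * inner ℝ (y k - u t k) (-u' k) = -2 * (star u' ⬝ᵥ (y - u t)).re := by
    rw [dotProduct, Complex.re_sum, Finset.mul_sum]
    refine Finset.sum_congr rfl fun k _ => ?_
    rw [Complex.inner]
    simp [Complex.mul_re]
    ring
  simp only [h3, Pi.neg_apply]
  ring

namespace HybridSystem

variable {NT NR NRFT NRFR NS : ℕ} (sys : HybridSystem NT NR NRFT NRFR NS)

/-- The partial derivatives of the noise-free signal: `α vec(W_RFᴴ Ṁ(θ) X)` in the angle,
`vec(W_RFᴴ M(θ) X)` in `α_R`, and `j vec(W_RFᴴ M(θ) X)` in `α_I`. -/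
def signalDeriv {L : ℕ} (S : Matrix (Fin NS) (Fin L) ℂ) (i : Fin 3) (ζ : Fin 3 → ℝ) :
    Fin L × Fin NRFR → ℂ :=
  ![(⟨ζ 1, ζ 2⟩ : ℂ) • vec (sys.WH * sys.Mdot (ζ 0) * sys.transmitted S),
    vec (sys.WH * sys.M (ζ 0) * sys.transmitted S),
    Complex.I • vec (sys.WH * sys.M (ζ 0) * sys.transmitted S)] i

theorem hasDerivAt_M (ha : Differentiable ℝ sys.a) (hb : Differentiable ℝ sys.b) (i : Fin NR)
    (j : Fin NT) (θ : ℝ) : HasDerivAt (fun t => sys.M t i j) (sys.Mdot θ i j) θ := by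
  have h1 : DifferentiableAt ℝ (fun t => sys.M t i j) θ := by
    have hai : DifferentiableAt ℝ (fun t => sys.a t j) θ := differentiableAt_pi.1 (ha θ) j
    have hbi : DifferentiableAt ℝ (fun t => sys.b t i) θ := differentiableAt_pi.1 (hb θ) i
    have : (fun t => sys.M t i j) = fun t => sys.b t i * star (sys.a t j) := by
      funext t; simp [M, vecMulVec_apply]
    rw [this]
    exact hbi.mul hai.star
  exact h1.hasDerivAt

theorem hasDerivAt_vec_mul_M_mul (ha : Differentiable ℝ sys.a) (hb : Differentiable ℝ sys.b)
    {κ : Type} (X : Matrix (Fin NT) κ ℂ) (θ : ℝ) (k : κ × Fin NRFR) :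
    HasDerivAt (fun t => vec (sys.WH * sys.M t * X) k) (vec (sys.WH * sys.Mdot θ * X) k) θ := by
  simp only [vec, Matrix.mul_apply]
  exact HasDerivAt.fun_sum fun b _ => (HasDerivAt.fun_sum fun c _ =>
    (sys.hasDerivAt_M ha hb c b θ).const_mul _).mul_const _

theorem hasDerivAt_signal (ha : Differentiable ℝ sys.a) (hb : Differentiable ℝ sys.b) {L : ℕ}
    (S : Matrix (Fin NS) (Fin L) ℂ) (i : Fin 3) (ζ : Fin 3 → ℝ) :
    HasDerivAt (fun t => sys.signal S (Function.update ζ i t)) (sys.signalDeriv S i ζ) (ζ i) := by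
  refine hasDerivAt_pi.2 fun k => ?_
  have hα : ∀ x y : ℝ, (⟨x, y⟩ : ℂ) = x + y * Complex.I := fun x y => by
    apply Complex.ext <;> simp
  fin_cases i
  · simp only [signal, signalDeriv, Pi.smul_apply, Function.update]
    simpa using (sys.hasDerivAt_vec_mul_M_mul ha hb (sys.transmitted S) (ζ 0) k).const_mul
      (⟨ζ 1, ζ 2⟩ : ℂ)
  · have h1 : HasDerivAt (fun t : ℝ => (t : ℂ) + ζ 2 * Complex.I) 1 (ζ 1) := by
      simpa using (Complex.ofRealCLM.hasDerivAt (x := ζ 1)).add_const (ζ 2 * Complex.I)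
    simpa [signal, signalDeriv, Function.update, hα] using
      h1.mul_const (vec (sys.WH * sys.M (ζ 0) * sys.transmitted S) k)
  · have h1 : HasDerivAt (fun t : ℝ => (ζ 1 : ℂ) + t * Complex.I) Complex.I (ζ 2) := by
      simpa using ((Complex.ofRealCLM.hasDerivAt (x := ζ 2)).mul_const Complex.I).const_add
        (ζ 1 : ℂ)
    simpa [signal, signalDeriv, Function.update, hα] using
      h1.mul_const (vec (sys.WH * sys.M (ζ 0) * sys.transmitted S) k)

theorem partialDeriv_signal (ha : Differentiable ℝ sys.a) (hb : Differentiable ℝ sys.b) {L : ℕ}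
    (S : Matrix (Fin NS) (Fin L) ℂ) (i : Fin 3) (ζ : Fin 3 → ℝ) :
    partialDeriv (sys.signal S) i ζ = sys.signalDeriv S i ζ :=
  (sys.hasDerivAt_signal ha hb S i ζ).deriv

/-- The score of the observation in closed form; `partialDeriv_log_likelihood` identifies it with
`∂_i ln p(y | ζ)`. -/
def score {L : ℕ} (S : Matrix (Fin NS) (Fin L) ℂ) (i : Fin 3) (ζ : Fin 3 → ℝ)
    (y : Fin L × Fin NRFR → ℂ) : ℝ :=
  2 / sys.combVar * (star (sys.signalDeriv S i ζ) ⬝ᵥ (y - sys.signal S ζ)).re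

theorem likelihood_pos (hNR : 0 < NR) (hdvd : NRFR ∣ NR) (hWH : IsPartiallyConnected sys.WH)
    (hσ : 0 < sys.noiseVar) {L : ℕ} (S : Matrix (Fin NS) (Fin L) ℂ) (ζ : Fin 3 → ℝ)
    (y : Fin L × Fin NRFR → ℂ) : 0 < sys.likelihood S ζ y := by
  have hc := sys.combVar_pos hNR hdvd hσ
  rw [sys.likelihood_eq hNR hdvd hWH hσ]
  positivity

theorem hasDerivAt_likelihood (hNR : 0 < NR) (hdvd : NRFR ∣ NR)
    (hWH : IsPartiallyConnected sys.WH) (hσ : 0 < sys.noiseVar) (ha : Differentiable ℝ sys.a)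
    (hb : Differentiable ℝ sys.b) {L : ℕ} (S : Matrix (Fin NS) (Fin L) ℂ) (i : Fin 3)
    (ζ : Fin 3 → ℝ) (y : Fin L × Fin NRFR → ℂ) :
    HasDerivAt (fun t => sys.likelihood S (Function.update ζ i t) y)
      (sys.score S i ζ y * sys.likelihood S ζ y) (ζ i) := by
  have h := hasDerivAt_exp_neg_sum_norm_sq (sys.hasDerivAt_signal ha hb S i ζ) y sys.combVar
    ((Real.pi * sys.combVar) ^ Fintype.card (Fin L × Fin NRFR))
  simp_rw [sys.likelihood_eq hNR hdvd hWH hσ]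
  rw [Function.update_eq_self] at h
  exact h

theorem partialDeriv_log_likelihood (hNR : 0 < NR) (hdvd : NRFR ∣ NR)
    (hWH : IsPartiallyConnected sys.WH) (hσ : 0 < sys.noiseVar) (ha : Differentiable ℝ sys.a)
    (hb : Differentiable ℝ sys.b) {L : ℕ} (S : Matrix (Fin NS) (Fin L) ℂ) (i : Fin 3)
    (ζ : Fin 3 → ℝ) (y : Fin L × Fin NRFR → ℂ) :
    partialDeriv (fun ζ' => Real.log (sys.likelihood S ζ' y)) i ζ = sys.score S i ζ y := by
  have hpos := (sys.likelihood_pos hNR hdvd hWH hσ S ζ y).ne'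
  have h := (sys.hasDerivAt_likelihood hNR hdvd hWH hσ ha hb S i ζ y).log
    (by rwa [Function.update_eq_self])
  rw [Function.update_eq_self, mul_div_assoc, div_self hpos, mul_one] at h
  exact h.deriv

theorem integral_obsLaw (hdvd : NRFR ∣ NR) (hWH : IsPartiallyConnected sys.WH)
    (hσ : 0 < sys.noiseVar) {L : ℕ} (S : Matrix (Fin NS) (Fin L) ℂ) (ζ : Fin 3 → ℝ)
    {g : (Fin L × Fin NRFR → ℂ) → ℝ} (hg : Measurable g) :
    ∫ y, g y ∂(sys.obsLaw S ζ) = ∫ n, g (sys.signal S ζ + n)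
      ∂(whiteCSCG (Fin L × Fin NRFR) sys.combVar.toNNReal) := by
  rw [sys.obsLaw_eq_map hdvd hWH hσ,
    integral_map (measurable_const_add _).aemeasurable hg.aestronglyMeasurable]

theorem measurable_score_right {L : ℕ} (S : Matrix (Fin NS) (Fin L) ℂ) (i : Fin 3)
    (ζ : Fin 3 → ℝ) : Measurable (sys.score S i ζ) := by
  have := measurable_re_star_dotProduct (sys.signalDeriv S i ζ)
  unfold score
  fun_prop

theorem score_signal_add {L : ℕ} (S : Matrix (Fin NS) (Fin L) ℂ) (i : Fin 3)
    (ζ : Fin 3 → ℝ) (n : Fin L × Fin NRFR → ℂ) : sys.score S i ζ (sys.signal S ζ + n) =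
      2 / sys.combVar * (star (sys.signalDeriv S i ζ) ⬝ᵥ n).re := by
  rw [score, add_sub_cancel_left]

theorem memLp_score (hdvd : NRFR ∣ NR) (hWH : IsPartiallyConnected sys.WH)
    (hσ : 0 < sys.noiseVar) {L : ℕ} (S : Matrix (Fin NS) (Fin L) ℂ) (i : Fin 3) (ζ : Fin 3 → ℝ) :
    MemLp (sys.score S i ζ) 2 (sys.obsLaw S ζ) := by
  rw [sys.obsLaw_eq_map hdvd hWH hσ, memLp_map_measure_iff
    (sys.measurable_score_right S i ζ).aestronglyMeasurable
    (measurable_const_add _).aemeasurable]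
  simp only [Function.comp_def, score_signal_add]
  exact (memLp_re_star_dotProduct_whiteCSCG _ _).const_mul _

theorem integral_score (hdvd : NRFR ∣ NR) (hWH : IsPartiallyConnected sys.WH)
    (hσ : 0 < sys.noiseVar) {L : ℕ} (S : Matrix (Fin NS) (Fin L) ℂ) (i : Fin 3) (ζ : Fin 3 → ℝ) :
    ∫ y, sys.score S i ζ y ∂(sys.obsLaw S ζ) = 0 := by
  rw [sys.integral_obsLaw hdvd hWH hσ S ζ (sys.measurable_score_right S i ζ)]
  simp_rw [score_signal_add]
  rw [integral_const_mul, integral_re_star_dotProduct_whiteCSCG, mul_zero]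

/-- The Fisher information of the observation at a fixed value of the parameter. -/
theorem integral_score_mul_score (hNR : 0 < NR) (hdvd : NRFR ∣ NR)
    (hWH : IsPartiallyConnected sys.WH) (hσ : 0 < sys.noiseVar) {L : ℕ}
    (S : Matrix (Fin NS) (Fin L) ℂ) (i j : Fin 3) (ζ : Fin 3 → ℝ) :
    ∫ y, sys.score S i ζ y * sys.score S j ζ y ∂(sys.obsLaw S ζ) =
      2 / sys.combVar * (star (sys.signalDeriv S i ζ) ⬝ᵥ sys.signalDeriv S j ζ).re := by
  have hc := sys.combVar_pos hNR hdvd hσ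
  rw [sys.integral_obsLaw hdvd hWH hσ S ζ (g := fun y => sys.score S i ζ y * sys.score S j ζ y)
    ((sys.measurable_score_right S i ζ).mul (sys.measurable_score_right S j ζ))]
  simp_rw [score_signal_add, mul_mul_mul_comm]
  rw [integral_const_mul, integral_re_star_dotProduct_mul_whiteCSCG, Real.coe_toNNReal _ hc.le]
  field_simp

theorem fimObs_eq_integral (hNR : 0 < NR) (hdvd : NRFR ∣ NR)
    (hWH : IsPartiallyConnected sys.WH) (hσ : 0 < sys.noiseVar) (ha : Differentiable ℝ sys.a)
    (hb : Differentiable ℝ sys.b) {L : ℕ} (S : Matrix (Fin NS) (Fin L) ℂ) (i j : Fin 3) :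
    sys.fimObs S i j = ∫ ζ, 2 / sys.combVar *
      (star (sys.signalDeriv S i ζ) ⬝ᵥ sys.signalDeriv S j ζ).re ∂sys.prior := by
  simp only [fimObs, of_apply]
  simp_rw [sys.partialDeriv_log_likelihood hNR hdvd hWH hσ ha hb,
    sys.integral_score_mul_score hNR hdvd hWH hσ]

/-- The Gaussian information formula, in terms of the covariance `C_y`. -/
theorem fimObs_eq_two_mul_integral (hNR : 0 < NR) (hdvd : NRFR ∣ NR)
    (hWH : IsPartiallyConnected sys.WH) (hσ : 0 < sys.noiseVar) (ha : Differentiable ℝ sys.a)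
    (hb : Differentiable ℝ sys.b) {L : ℕ} (S : Matrix (Fin NS) (Fin L) ℂ) (i j : Fin 3) :
    sys.fimObs S i j = 2 * ∫ ζ, (star (partialDeriv (sys.signal S) i ζ) ⬝ᵥ
      ((sys.noiseCov L)⁻¹ *ᵥ partialDeriv (sys.signal S) j ζ)).re ∂sys.prior := by
  rw [sys.fimObs_eq_integral hNR hdvd hWH hσ ha hb, ← integral_const_mul]
  refine integral_congr_ae (.of_forall fun ζ => ?_)
  simp only [sys.partialDeriv_signal ha hb, sys.noiseCov_inv hNR hdvd hWH hσ, smul_mulVec,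
    one_mulVec, dotProduct_smul, smul_eq_mul, Complex.re_ofReal_mul]
  ring

end HybridSystem

/-! ### Laws given by densities, and the prior -/

/-- The law with density `p`. -/
def densityLaw {E : Type*} [MeasureSpace E] (p : E → ℝ) : Measure E :=
  (volume : Measure E).withDensity fun x => ENNReal.ofReal (p x)

theorem integral_densityLaw {E F : Type*} [MeasureSpace E] [NormedAddCommGroup F]
    [NormedSpace ℝ F] {p : E → ℝ} (hp : Measurable p) (hp0 : ∀ x, 0 ≤ p x) (g : E → F) :
    ∫ x, g x ∂(densityLaw p) = ∫ x, p x • g x := by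
  rw [densityLaw, integral_withDensity_eq_integral_toReal_smul (by fun_prop) (by simp)]
  simp [ENNReal.toReal_ofReal (hp0 _)]

theorem integrable_densityLaw_iff {E F : Type*} [MeasureSpace E] [NormedAddCommGroup F]
    [NormedSpace ℝ F] {p : E → ℝ} (hp : Measurable p) (hp0 : ∀ x, 0 ≤ p x) {g : E → F} :
    Integrable g (densityLaw p) ↔ Integrable fun x => p x • g x := by
  rw [densityLaw, integrable_withDensity_iff_integrable_smul' (by fun_prop) (by simp)]
  simp [ENNReal.toReal_ofReal (hp0 _)]

theorem isProbabilityMeasure_densityLaw {E : Type*} [MeasureSpace E] {p : E → ℝ}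
    (hp0 : ∀ x, 0 ≤ p x) (h1 : ∫ x, p x = 1) : IsProbabilityMeasure (densityLaw p) := by
  have hi : Integrable p := by
    by_contra h
    rw [integral_undef h] at h1
    exact zero_ne_one h1
  refine ⟨?_⟩
  rw [densityLaw, withDensity_apply _ MeasurableSet.univ, setLIntegral_univ,
    ← ofReal_integral_eq_lintegral_ofReal hi (.of_forall hp0), h1, ENNReal.ofReal_one]

theorem memLp_two_densityLaw {E F : Type*} [MeasureSpace E] [NormedAddCommGroup F]
    [NormedSpace ℝ F] {p : E → ℝ} (hp : Measurable p) (hp0 : ∀ x, 0 ≤ p x) {g : E → F}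
    (hg : AEStronglyMeasurable g) (h2 : Integrable fun x => ‖g x‖ ^ 2 * p x) :
    MemLp g 2 (densityLaw p) := by
  have hg' : AEStronglyMeasurable g (densityLaw p) :=
    hg.mono_ac (withDensity_absolutelyContinuous _ _)
  rw [memLp_two_iff_integrable_sq_norm hg',
    integrable_densityLaw_iff hp hp0]
  simpa [mul_comm] using h2

/-- The parameter `ζ = (θ, α_R, α_I)` as a function of the pair of `θ` and `(α_R, α_I)`. -/
def param : ℝ × ℝ × ℝ ≃ᵐ (Fin 3 → ℝ) :=
  (((MeasurableEquiv.piFinSuccAbove (fun _ => ℝ) 0).trans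
    ((MeasurableEquiv.refl ℝ).prodCongr MeasurableEquiv.finTwoArrow))).symm

theorem param_apply (q : ℝ × ℝ × ℝ) : param q = ![q.1, q.2.1, q.2.2] := by
  rw [param, MeasurableEquiv.symm_apply_eq]
  rfl

theorem measurePreserving_param : MeasurePreserving param := by
  refine MeasurePreserving.symm _ ?_
  exact ((MeasurePreserving.id (volume : Measure ℝ)).prod (volume_preserving_finTwoArrow ℝ)).comp
    (volume_preserving_piFinSuccAbove (fun _ => ℝ) 0)

namespace HybridSystem

variable {NT NR NRFT NRFR NS : ℕ} (sys : HybridSystem NT NR NRFT NRFR NS)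

/-- The assumptions on the prior: differentiable densities of finite Fisher information, and a
centred reflection coefficient of finite second moment. -/
structure IsRegularPrior : Prop where
  theta_nonneg : ∀ θ, 0 ≤ sys.pTheta θ
  integral_theta : ∫ θ, sys.pTheta θ = 1
  differentiable_theta : Differentiable ℝ sys.pTheta
  theta_info : Integrable fun θ =>
    (deriv (fun t => Real.log (sys.pTheta t)) θ) ^ 2 * sys.pTheta θ
  alpha_nonneg : ∀ x, 0 ≤ sys.pAlpha x
  integral_alpha : ∫ x, sys.pAlpha x = 1
  differentiable_alpha : Differentiable ℝ sys.pAlpha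
  alpha_infoR : Integrable fun x : ℝ × ℝ =>
    (deriv (fun t => Real.log (sys.pAlpha (t, x.2))) x.1) ^ 2 * sys.pAlpha x
  alpha_infoI : Integrable fun x : ℝ × ℝ =>
    (deriv (fun t => Real.log (sys.pAlpha (x.1, t))) x.2) ^ 2 * sys.pAlpha x
  alpha_sq : Integrable fun x : ℝ × ℝ => (x.1 ^ 2 + x.2 ^ 2) * sys.pAlpha x
  alpha_meanR : ∫ x : ℝ × ℝ, x.1 * sys.pAlpha x = 0
  alpha_meanI : ∫ x : ℝ × ℝ, x.2 * sys.pAlpha x = 0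

/-- The prior law of the angle. -/
abbrev thetaLaw : Measure ℝ := densityLaw sys.pTheta

/-- The prior law of the reflection coefficient. -/
abbrev alphaLaw : Measure (ℝ × ℝ) := densityLaw sys.pAlpha

namespace IsRegularPrior

variable {sys} (hp : sys.IsRegularPrior)
include hp

theorem measurable_theta : Measurable sys.pTheta := hp.differentiable_theta.continuous.measurable

theorem measurable_alpha : Measurable sys.pAlpha := hp.differentiable_alpha.continuous.measurable

theorem isProbabilityMeasure_thetaLaw : IsProbabilityMeasure sys.thetaLaw :=
  isProbabilityMeasure_densityLaw hp.theta_nonneg hp.integral_theta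

theorem isProbabilityMeasure_alphaLaw : IsProbabilityMeasure sys.alphaLaw :=
  isProbabilityMeasure_densityLaw hp.alpha_nonneg hp.integral_alpha

theorem integral_thetaLaw (g : ℝ → ℝ) : ∫ θ, g θ ∂sys.thetaLaw = ∫ θ, g θ * sys.pTheta θ := by
  simp [integral_densityLaw hp.measurable_theta hp.theta_nonneg, mul_comm]

theorem integral_alphaLaw (g : ℝ × ℝ → ℝ) :
    ∫ x, g x ∂sys.alphaLaw = ∫ x, g x * sys.pAlpha x := by
  simp [integral_densityLaw hp.measurable_alpha hp.alpha_nonneg, mul_comm]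

theorem priorPDF_nonneg (ζ : Fin 3 → ℝ) : 0 ≤ sys.priorPDF ζ :=
  mul_nonneg (hp.theta_nonneg _) (hp.alpha_nonneg _)

theorem differentiable_priorPDF : Differentiable ℝ sys.priorPDF := by
  have h1 := hp.differentiable_theta
  have h2 := hp.differentiable_alpha
  unfold priorPDF
  fun_prop

theorem prior_eq_map : sys.prior = (sys.thetaLaw.prod sys.alphaLaw).map param := by
  have h1 := hp.measurable_theta
  have h2 := hp.measurable_alpha
  have h3 := hp.differentiable_priorPDF.continuous.measurable
  rw [thetaLaw, alphaLaw, densityLaw, densityLaw, prod_withDensity (by fun_prop) (by fun_prop)]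
  ext s hs
  rw [MeasurableEquiv.map_apply, prior, withDensity_apply _ hs,
    withDensity_apply _ (param.measurable hs),
    ← measurePreserving_param.setLIntegral_comp_preimage hs (by fun_prop)]
  refine setLIntegral_congr_fun (param.measurable hs) fun q _ => ?_
  simp [priorPDF, param_apply, ENNReal.ofReal_mul (hp.theta_nonneg _)]

theorem isProbabilityMeasure_prior : IsProbabilityMeasure sys.prior := by
  have := hp.isProbabilityMeasure_thetaLaw
  have := hp.isProbabilityMeasure_alphaLaw
  rw [hp.prior_eq_map]
  exact Measure.isProbabilityMeasure_map param.measurable.aemeasurable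

theorem integral_prior (g : (Fin 3 → ℝ) → ℝ) :
    ∫ ζ, g ζ ∂sys.prior = ∫ q, g ![q.1, q.2.1, q.2.2] ∂(sys.thetaLaw.prod sys.alphaLaw) := by
  rw [hp.prior_eq_map, integral_map_equiv]
  simp_rw [param_apply]

theorem integrable_prior_iff (g : (Fin 3 → ℝ) → ℝ) : Integrable g sys.prior ↔
    Integrable (fun q : ℝ × ℝ × ℝ => g ![q.1, q.2.1, q.2.2])
      (sys.thetaLaw.prod sys.alphaLaw) := by
  rw [hp.prior_eq_map, integrable_map_equiv]
  simp only [Function.comp_def, param_apply]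

/-- The angle and the reflection coefficient are independent under the prior. -/
theorem integral_prior_mul (f : ℝ → ℝ) (g : ℝ × ℝ → ℝ) :
    ∫ ζ, f (ζ 0) * g (ζ 1, ζ 2) ∂sys.prior =
      (∫ θ, f θ ∂sys.thetaLaw) * ∫ x, g x ∂sys.alphaLaw := by
  have := hp.isProbabilityMeasure_thetaLaw
  have := hp.isProbabilityMeasure_alphaLaw
  rw [hp.integral_prior, ← integral_prod_mul]
  rfl

theorem integrable_prior_mul {f : ℝ → ℝ} {g : ℝ × ℝ → ℝ} (hf : Integrable f sys.thetaLaw)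
    (hg : Integrable g sys.alphaLaw) :
    Integrable (fun ζ => f (ζ 0) * g (ζ 1, ζ 2)) sys.prior := by
  have := hp.isProbabilityMeasure_thetaLaw
  have := hp.isProbabilityMeasure_alphaLaw
  rw [hp.integrable_prior_iff]
  exact hf.mul_prod hg

theorem integral_prior_theta (f : ℝ → ℝ) : ∫ ζ, f (ζ 0) ∂sys.prior = ∫ θ, f θ ∂sys.thetaLaw := by
  have := hp.isProbabilityMeasure_alphaLaw
  simpa using hp.integral_prior_mul f fun _ => 1

theorem memLp_alpha_re : MemLp (fun x : ℝ × ℝ => x.1) 2 sys.alphaLaw := by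
  refine memLp_two_densityLaw hp.measurable_alpha hp.alpha_nonneg (by fun_prop) ?_
  have h2 := hp.measurable_alpha
  refine hp.alpha_sq.mono' (Measurable.aestronglyMeasurable (by fun_prop)) (.of_forall fun x => ?_)
  have h0 := hp.alpha_nonneg x
  rw [norm_mul, norm_pow, norm_norm, Real.norm_of_nonneg h0, Real.norm_eq_abs, sq_abs]
  exact mul_le_mul_of_nonneg_right (by nlinarith) h0

theorem memLp_alpha_im : MemLp (fun x : ℝ × ℝ => x.2) 2 sys.alphaLaw := by
  refine memLp_two_densityLaw hp.measurable_alpha hp.alpha_nonneg (by fun_prop) ?_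
  have h2 := hp.measurable_alpha
  refine hp.alpha_sq.mono' (Measurable.aestronglyMeasurable (by fun_prop)) (.of_forall fun x => ?_)
  have h0 := hp.alpha_nonneg x
  rw [norm_mul, norm_pow, norm_norm, Real.norm_of_nonneg h0, Real.norm_eq_abs, sq_abs]
  exact mul_le_mul_of_nonneg_right (by nlinarith) h0

end IsRegularPrior

end HybridSystem

/-! ### The observation information matrix -/

theorem memLp_vec_mul_mul {α : Type*} [MeasurableSpace α] {μ : Measure α} {m n k l : Type}
    [Fintype m] [Fintype n] {D : α → Matrix m n ℂ} (hD : ∀ i j, MemLp (fun x => D x i j) 2 μ)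
    (A : Matrix k m ℂ) (X : Matrix n l ℂ) (i : l × k) :
    MemLp (fun x => vec (A * D x * X) i) 2 μ := by
  have h1 : ∀ b, MemLp (fun x => ∑ c, A i.2 c * D x c b) 2 μ := fun b =>
    memLp_finsetSum _ fun c _ => (hD c b).const_mul _
  have h2 : MemLp (fun x => ∑ b, (∑ c, A i.2 c * D x c b) * X b i.1) 2 μ :=
    memLp_finsetSum _ fun b _ => (h1 b).mul_const _
  simpa only [vec, Matrix.mul_apply] using h2

theorem integrable_star_dotProduct {α : Type*} [MeasurableSpace α] {μ : Measure α} {ι : Type}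
    [Fintype ι] {f g : α → ι → ℂ} (hf : ∀ i, MemLp (fun x => f x i) 2 μ)
    (hg : ∀ i, MemLp (fun x => g x i) 2 μ) : Integrable (fun x => star (f x) ⬝ᵥ g x) μ := by
  simp only [dotProduct]
  exact integrable_finsetSum _ fun i _ => (hf i).star.integrable_mul (hg i)

/-- The trace of an averaged Gram matrix against `X Xᴴ` is an averaged squared norm. -/
theorem re_trace_integral_gram_mul {α : Type*} [MeasurableSpace α] {μ : Measure α}
    {m n k l : Type} [Fintype m] [Fintype n] [Fintype k] [Fintype l] {D : α → Matrix m n ℂ}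
    (hD : ∀ i j, MemLp (fun x => D x i j) 2 μ) (A : Matrix k m ℂ) (X : Matrix n l ℂ) :
    ((Matrix.of fun i j => ∫ x, ((D x)ᴴ * Aᴴ * A * D x) i j ∂μ) * (X * Xᴴ)).trace.re =
      ∫ x, (star (vec (A * D x * X)) ⬝ᵥ vec (A * D x * X)).re ∂μ := by
  classical
  have hG : ∀ i j, Integrable (fun x => ((D x)ᴴ * Aᴴ * A * D x) i j) μ := by
    intro i j
    have h1 : ∀ b (c : k), MemLp (fun x => (A * D x) c b) 2 μ := by
      intro b c
      simpa [vec] using memLp_vec_mul_mul hD A (1 : Matrix n n ℂ) (b, c)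
    have h2 : ∀ x, ((D x)ᴴ * Aᴴ * A * D x) i j =
        star (fun c => (A * D x) c i) ⬝ᵥ fun c => (A * D x) c j := by
      intro x
      rw [← conjTranspose_mul, Matrix.mul_assoc, Matrix.mul_apply]
      rfl
    simp_rw [h2]
    exact integrable_star_dotProduct (h1 i) (h1 j)
  have h3 : ∀ x, star (vec (A * D x * X)) ⬝ᵥ vec (A * D x * X) =
      ∑ i, ∑ j, ((D x)ᴴ * Aᴴ * A * D x) i j * (X * Xᴴ) j i := by
    intro x
    have h4 : ∑ i, ∑ j, ((D x)ᴴ * Aᴴ * A * D x) i j * (X * Xᴴ) j i =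
        (((D x)ᴴ * Aᴴ * A * D x) * (X * Xᴴ)).trace := rfl
    rw [h4, star_vec_dotProduct_vec, conjTranspose_mul, Matrix.mul_assoc, trace_mul_comm,
      conjTranspose_mul]
    simp only [Matrix.mul_assoc]
  simp_rw [h3]
  have hI : ∀ i j, Integrable (fun x => ((D x)ᴴ * Aᴴ * A * D x) i j * (X * Xᴴ) j i) μ :=
    fun i j => (hG i j).mul_const _
  have h4 := integral_re (μ := μ) (𝕜 := ℂ) (integrable_finsetSum Finset.univ fun i _ =>
    integrable_finsetSum Finset.univ fun j _ => hI i j)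
  simp only [RCLike.re_eq_complex_re] at h4
  rw [h4, integral_finsetSum _ fun i _ => integrable_finsetSum Finset.univ fun j _ => hI i j]
  simp_rw [integral_finsetSum _ fun j _ => hI _ j, integral_mul_const]
  rfl

namespace HybridSystem

variable {NT NR NRFT NRFR NS : ℕ} (sys : HybridSystem NT NR NRFT NRFR NS)

theorem sampleCov_eq {L : ℕ} (S : Matrix (Fin NS) (Fin L) ℂ) :
    sys.sampleCov S = (L : ℂ)⁻¹ • (sys.transmitted S * (sys.transmitted S)ᴴ) := by
  unfold sampleCov
  congr 1
  ext i j
  simp [Matrix.sum_apply, vecMulVec_apply, Matrix.mul_apply]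

theorem natCast_mul_re_trace_mul_sampleCov {L : ℕ} (hL : 0 < L) (S : Matrix (Fin NS) (Fin L) ℂ)
    (A : Matrix (Fin NT) (Fin NT) ℂ) : L * (A * sys.sampleCov S).trace.re =
      (A * (sys.transmitted S * (sys.transmitted S)ᴴ)).trace.re := by
  have hL' : (L : ℝ) ≠ 0 := by exact_mod_cast hL.ne'
  have : ((L : ℂ)⁻¹ : ℂ) = (((L : ℝ)⁻¹ : ℝ) : ℂ) := by push_cast; rfl
  rw [sys.sampleCov_eq, Matrix.mul_smul, trace_smul, smul_eq_mul, this, Complex.re_ofReal_mul,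
    mul_inv_cancel_left₀ hL']

variable {sys}

/-- `tr(A X Xᴴ) = E[‖vec(W_RFᴴ D(θ) X)‖²]`, where `A = E[D(θ)ᴴ W_RF W_RFᴴ D(θ)]`. With `D = Ṁ` and
`D = M` this covers `A₁` and `A₂`. -/
theorem IsRegularPrior.re_trace_gram_mul (hp : sys.IsRegularPrior)
    {D : ℝ → Matrix (Fin NR) (Fin NT) ℂ}
    (hD : ∀ i j, MemLp (fun θ => D θ i j) 2 sys.thetaLaw) {l : Type} [Fintype l]
    (X : Matrix (Fin NT) l ℂ) :
    ((Matrix.of fun i j => ∫ θ, ((D θ)ᴴ * sys.WHᴴ * sys.WH * D θ) i j * (sys.pTheta θ : ℂ)) *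
      (X * Xᴴ)).trace.re =
      ∫ θ, (star (vec (sys.WH * D θ * X)) ⬝ᵥ vec (sys.WH * D θ * X)).re ∂sys.thetaLaw := by
  rw [← re_trace_integral_gram_mul hD]
  simp_rw [integral_densityLaw hp.measurable_theta hp.theta_nonneg, Complex.real_smul, mul_comm]

theorem IsRegularPrior.memLp_M (hp : sys.IsRegularPrior) (ha : Differentiable ℝ sys.a)
    (hb : Differentiable ℝ sys.b)
    (hM : ∀ i j, Integrable fun θ => ‖sys.M θ i j‖ ^ 2 * sys.pTheta θ) (i : Fin NR) (j : Fin NT) :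
    MemLp (fun θ => sys.M θ i j) 2 sys.thetaLaw := by
  refine memLp_two_densityLaw hp.measurable_theta hp.theta_nonneg ?_ (hM i j)
  have : Continuous fun θ => sys.M θ i j :=
    continuous_iff_continuousAt.2 fun θ => (sys.hasDerivAt_M ha hb i j θ).continuousAt
  exact this.aestronglyMeasurable

theorem IsRegularPrior.memLp_Mdot (hp : sys.IsRegularPrior)
    (hMdot : ∀ i j, Integrable fun θ => ‖sys.Mdot θ i j‖ ^ 2 * sys.pTheta θ) (i : Fin NR)
    (j : Fin NT) : MemLp (fun θ => sys.Mdot θ i j) 2 sys.thetaLaw := by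
  refine memLp_two_densityLaw hp.measurable_theta hp.theta_nonneg ?_ (hMdot i j)
  exact (measurable_deriv fun t => sys.M t i j).aestronglyMeasurable

theorem two_div_combVar : 2 / sys.combVar = 2 * NRFR / (NR * sys.noiseVar) := by
  rw [combVar, div_mul_eq_mul_div, div_div_eq_mul_div]

theorem re_star_smul_dotProduct_smul {ι : Type} [Fintype ι] (c : ℂ) (v : ι → ℂ) :
    (star (c • v) ⬝ᵥ (c • v)).re = (star v ⬝ᵥ v).re * (c.re ^ 2 + c.im ^ 2) := by
  rw [star_smul, smul_dotProduct, dotProduct_smul, smul_smul, smul_eq_mul, Complex.star_def,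
    ← Complex.normSq_eq_conj_mul_self, Complex.re_ofReal_mul, Complex.normSq_apply]
  ring

theorem fimObs_zero_zero (hp : sys.IsRegularPrior) (hNR : 0 < NR) (hdvd : NRFR ∣ NR)
    (hWH : IsPartiallyConnected sys.WH) (hσ : 0 < sys.noiseVar) (ha : Differentiable ℝ sys.a)
    (hb : Differentiable ℝ sys.b)
    (hMdot : ∀ i j, Integrable fun θ => ‖sys.Mdot θ i j‖ ^ 2 * sys.pTheta θ)
    {L : ℕ} (hL : 0 < L) (S : Matrix (Fin NS) (Fin L) ℂ) :
    sys.fimObs S 0 0 = 2 * NRFR * L * sys.gam / (NR * sys.noiseVar) *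
      (sys.A₁ * sys.sampleCov S).trace.re := by
  have h1 : 2 * NRFR * L * sys.gam / (NR * sys.noiseVar) * (sys.A₁ * sys.sampleCov S).trace.re =
      2 / sys.combVar * ((L * (sys.A₁ * sys.sampleCov S).trace.re) * sys.gam) := by
    rw [two_div_combVar]; ring
  rw [h1, sys.natCast_mul_re_trace_mul_sampleCov hL, A₁,
    hp.re_trace_gram_mul (hp.memLp_Mdot hMdot), gam, ← hp.integral_alphaLaw,
    ← hp.integral_prior_mul, sys.fimObs_eq_integral hNR hdvd hWH hσ ha hb, integral_const_mul]
  simp only [signalDeriv, cons_val_zero, re_star_smul_dotProduct_smul]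

theorem fimObs_comm {L : ℕ} (S : Matrix (Fin NS) (Fin L) ℂ) (i j : Fin 3) :
    sys.fimObs S i j = sys.fimObs S j i := by
  simp only [fimObs, of_apply, mul_comm]

/-- The derivative of the signal in a coordinate of `α` is `β vec(W_RFᴴ M(θ) X)`, with a constant
`β`. -/
theorem exists_signalDeriv_eq_smul {L : ℕ} (S : Matrix (Fin NS) (Fin L) ℂ) {k : Fin 3}
    (hk : k ≠ 0) : ∃ β : ℂ, ∀ ζ, sys.signalDeriv S k ζ =
      β • vec (sys.WH * sys.M (ζ 0) * sys.transmitted S) := by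
  fin_cases k
  · exact absurd rfl hk
  · exact ⟨1, fun ζ => by rw [one_smul]; rfl⟩
  · exact ⟨Complex.I, fun ζ => rfl⟩

/-- `E[Re(conj(α) g(θ))] = 0`, as `α` is centred and independent of `θ`. -/
theorem IsRegularPrior.integral_re_add_im_mul_alpha (hp : sys.IsRegularPrior) {g : ℝ → ℂ}
    (hg : Integrable g sys.thetaLaw) :
    ∫ ζ, ((g (ζ 0)).re * ζ 1 + (g (ζ 0)).im * ζ 2) ∂sys.prior = 0 := by
  have := hp.isProbabilityMeasure_alphaLaw
  have i1 : Integrable (fun ζ : Fin 3 → ℝ => (g (ζ 0)).re * ζ 1) sys.prior :=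
    hp.integrable_prior_mul (f := fun θ => (g θ).re) (g := fun x => x.1) hg.re
      (hp.memLp_alpha_re.integrable one_le_two)
  have i2 : Integrable (fun ζ : Fin 3 → ℝ => (g (ζ 0)).im * ζ 2) sys.prior :=
    hp.integrable_prior_mul (f := fun θ => (g θ).im) (g := fun x => x.2) hg.im
      (hp.memLp_alpha_im.integrable one_le_two)
  rw [integral_add i1 i2, hp.integral_prior_mul (fun θ => (g θ).re) fun x => x.1,
    hp.integral_prior_mul (fun θ => (g θ).im) fun x => x.2,
    hp.integral_alphaLaw, hp.integral_alphaLaw, hp.alpha_meanR, hp.alpha_meanI, mul_zero, mul_zero,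
    add_zero]

theorem fimObs_zero_eq_zero (hp : sys.IsRegularPrior) (hNR : 0 < NR) (hdvd : NRFR ∣ NR)
    (hWH : IsPartiallyConnected sys.WH) (hσ : 0 < sys.noiseVar) (ha : Differentiable ℝ sys.a)
    (hb : Differentiable ℝ sys.b)
    (hM : ∀ i j, Integrable fun θ => ‖sys.M θ i j‖ ^ 2 * sys.pTheta θ)
    (hMdot : ∀ i j, Integrable fun θ => ‖sys.Mdot θ i j‖ ^ 2 * sys.pTheta θ)
    {L : ℕ} (S : Matrix (Fin NS) (Fin L) ℂ) {k : Fin 3} (hk : k ≠ 0) :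
    sys.fimObs S 0 k = 0 := by
  obtain ⟨β, hβ⟩ := exists_signalDeriv_eq_smul (sys := sys) S hk
  have hgi : Integrable (fun θ => (star (vec (sys.WH * sys.Mdot θ * sys.transmitted S)) ⬝ᵥ
      vec (sys.WH * sys.M θ * sys.transmitted S)) * β) sys.thetaLaw :=
    (integrable_star_dotProduct (memLp_vec_mul_mul (hp.memLp_Mdot hMdot) _ _)
      (memLp_vec_mul_mul (hp.memLp_M ha hb hM) _ _)).mul_const β
  have h1 : ∀ ζ : Fin 3 → ℝ, (star (sys.signalDeriv S 0 ζ) ⬝ᵥ sys.signalDeriv S k ζ) =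
      star (⟨ζ 1, ζ 2⟩ : ℂ) * ((star (vec (sys.WH * sys.Mdot (ζ 0) * sys.transmitted S)) ⬝ᵥ
        vec (sys.WH * sys.M (ζ 0) * sys.transmitted S)) * β) := by
    intro ζ
    rw [hβ, signalDeriv, cons_val_zero, star_smul, smul_dotProduct, dotProduct_smul, smul_eq_mul,
      smul_eq_mul, mul_comm β]
  have h2 : ∀ (x y : ℝ) (z : ℂ), (star (⟨x, y⟩ : ℂ) * z).re = z.re * x + z.im * y := by
    intro x y z
    simp only [Complex.star_def, Complex.mul_re, Complex.conj_re, Complex.conj_im]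
    ring
  rw [sys.fimObs_eq_integral hNR hdvd hWH hσ ha hb, integral_const_mul]
  simp_rw [h1, h2]
  rw [hp.integral_re_add_im_mul_alpha hgi, mul_zero]

/-- The block of `α`: its off-diagonal entries vanish because `vᴴ (j v)` is purely imaginary. -/
theorem fimObs_alpha (hp : sys.IsRegularPrior) (hNR : 0 < NR) (hdvd : NRFR ∣ NR)
    (hWH : IsPartiallyConnected sys.WH) (hσ : 0 < sys.noiseVar) (ha : Differentiable ℝ sys.a)
    (hb : Differentiable ℝ sys.b)
    (hM : ∀ i j, Integrable fun θ => ‖sys.M θ i j‖ ^ 2 * sys.pTheta θ)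
    {L : ℕ} (hL : 0 < L) (S : Matrix (Fin NS) (Fin L) ℂ) {k m : Fin 3} (hk : k ≠ 0) (hm : m ≠ 0) :
    sys.fimObs S k m = if k = m then 2 * NRFR * L / (NR * sys.noiseVar) *
      (sys.A₂ * sys.sampleCov S).trace.re else 0 := by
  have h1 : 2 * NRFR * L / (NR * sys.noiseVar) * (sys.A₂ * sys.sampleCov S).trace.re =
      2 / sys.combVar * (L * (sys.A₂ * sys.sampleCov S).trace.re) := by
    rw [two_div_combVar]; ring
  rw [h1, sys.natCast_mul_re_trace_mul_sampleCov hL, A₂,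
    hp.re_trace_gram_mul (hp.memLp_M ha hb hM),
    ← hp.integral_prior_theta, sys.fimObs_eq_integral hNR hdvd hWH hσ ha hb, integral_const_mul]
  have him : ∀ v : Fin L × Fin NRFR → ℂ, (star v ⬝ᵥ v).im = 0 := fun v =>
    (Complex.conj_eq_iff_im.1 (by rw [← Complex.star_def, ← star_dotProduct]))
  fin_cases k <;> fin_cases m
  all_goals first | exact absurd rfl hk | exact absurd rfl hm | skip
  · simp [signalDeriv]
  · simp [signalDeriv, him]
  · simp [signalDeriv, star_smul, him]
  · simp [signalDeriv, star_smul]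

theorem fimObs_posSemidef (hp : sys.IsRegularPrior) (hNR : 0 < NR) (hdvd : NRFR ∣ NR)
    (hWH : IsPartiallyConnected sys.WH) (hσ : 0 < sys.noiseVar) (ha : Differentiable ℝ sys.a)
    (hb : Differentiable ℝ sys.b)
    (hM : ∀ i j, Integrable fun θ => ‖sys.M θ i j‖ ^ 2 * sys.pTheta θ)
    (hMdot : ∀ i j, Integrable fun θ => ‖sys.Mdot θ i j‖ ^ 2 * sys.pTheta θ)
    {L : ℕ} (hL : 0 < L) (S : Matrix (Fin NS) (Fin L) ℂ) : (sys.fimObs S).PosSemidef := by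
  have hdiag : sys.fimObs S = diagonal fun i => sys.fimObs S i i := by
    ext i j
    rw [diagonal_apply]
    split_ifs with hij
    · rw [hij]
    · by_cases hi : i = 0
      · subst hi
        exact fimObs_zero_eq_zero hp hNR hdvd hWH hσ ha hb hM hMdot S (Ne.symm hij)
      · by_cases hj : j = 0
        · subst hj
          rw [fimObs_comm]
          exact fimObs_zero_eq_zero hp hNR hdvd hWH hσ ha hb hM hMdot S hi
        · rw [fimObs_alpha hp hNR hdvd hWH hσ ha hb hM hL S hi hj, if_neg hij]
  rw [hdiag]
  refine PosSemidef.diagonal fun i => ?_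
  simp only [fimObs, of_apply, Pi.zero_apply]
  exact integral_nonneg fun ζ => integral_nonneg fun y => mul_self_nonneg _

end HybridSystem

/-! ### The prior information matrix -/

theorem hasDerivAt_comp_update {p : (Fin 3 → ℝ) → ℝ} (hp : Differentiable ℝ p) (ζ : Fin 3 → ℝ)
    (i : Fin 3) :
    HasDerivAt (fun t => p (Function.update ζ i t)) (fderiv ℝ p ζ (Pi.single i 1)) (ζ i) := by
  have h1 := hasDerivAt_update ζ i (ζ i)
  have h2 := (hp (Function.update ζ i (ζ i))).hasFDerivAt.comp_hasDerivAt (ζ i) h1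
  rw [Function.update_eq_self] at h2
  exact h2

/-- Where a nonnegative function vanishes so does its derivative, so that `f' / f` times `f` is `f'`
everywhere, with `f' / f = 0` at the zeros. -/
theorem deriv_div_mul_self {f : ℝ → ℝ} (hf0 : ∀ x, 0 ≤ f x) (x : ℝ) :
    deriv f x / f x * f x = deriv f x := by
  by_cases h : f x = 0
  · have hmin : IsLocalMin f x := .of_forall fun t => by rw [h]; exact hf0 t
    rw [h, mul_zero, hmin.deriv_eq_zero]
  · rw [div_mul_cancel₀ _ h]

theorem fderiv_div_mul_self {E : Type*} [NormedAddCommGroup E] [NormedSpace ℝ E] {f : E → ℝ}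
    (hf0 : ∀ x, 0 ≤ f x) (x v : E) : fderiv ℝ f x v / f x * f x = fderiv ℝ f x v := by
  by_cases h : f x = 0
  · have hmin : IsLocalMin f x := .of_forall fun t => by rw [h]; exact hf0 t
    rw [h, mul_zero, hmin.fderiv_eq_zero, _root_.zero_apply]
  · rw [div_mul_cancel₀ _ h]

theorem deriv_log_sq_mul_self {f : ℝ → ℝ} {x : ℝ} (hf : DifferentiableAt ℝ f x) :
    (deriv (fun t => Real.log (f t)) x) ^ 2 * f x = (deriv f x / f x) ^ 2 * f x := by
  by_cases h : f x = 0
  · simp [h]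
  · rw [deriv.log hf h]

theorem memLp_two_densityLaw_of_sq {E : Type*} [MeasureSpace E] {p s : E → ℝ} (hp : Measurable p)
    (hp0 : ∀ x, 0 ≤ p x) (hs : Measurable s) (h : Integrable fun x => s x ^ 2 * p x) :
    MemLp s 2 (densityLaw p) :=
  memLp_two_densityLaw hp hp0 hs.aestronglyMeasurable (by simpa using h)

namespace HybridSystem

variable {NT NR NRFT NRFR NS : ℕ} (sys : HybridSystem NT NR NRFT NRFR NS)

/-- The score `p_Θ' / p_Θ` of the angle prior, equal to zero where `p_Θ` vanishes. -/
def thetaScore (θ : ℝ) : ℝ := deriv sys.pTheta θ / sys.pTheta θ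

/-- The score of the reflection coefficient prior in the direction `v`, equal to zero where `p_α`
vanishes. As a quotient of measurable functions it is measurable. -/
def alphaScore (v x : ℝ × ℝ) : ℝ := fderiv ℝ sys.pAlpha x v / sys.pAlpha x

/-- The score `∂_i ln p_Z(ζ)` of the prior, in the form `∂_i p_Z / p_Z`. -/
def priorScore (i : Fin 3) (ζ : Fin 3 → ℝ) : ℝ :=
  ![sys.thetaScore (ζ 0), sys.alphaScore (1, 0) (ζ 1, ζ 2), sys.alphaScore (0, 1) (ζ 1, ζ 2)] i

theorem measurable_thetaScore (h : Measurable sys.pTheta) : Measurable sys.thetaScore :=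
  (measurable_deriv _).div h

theorem measurable_alphaScore (h : Measurable sys.pAlpha) (v : ℝ × ℝ) :
    Measurable (sys.alphaScore v) :=
  (measurable_fderiv_apply_const ℝ sys.pAlpha v).div h

variable {sys}

namespace IsRegularPrior

theorem hasDerivAt_pTheta (hp : sys.IsRegularPrior) (θ : ℝ) :
    HasDerivAt sys.pTheta (sys.thetaScore θ * sys.pTheta θ) θ := by
  rw [thetaScore, deriv_div_mul_self hp.theta_nonneg]
  exact (hp.differentiable_theta θ).hasDerivAt

theorem hasDerivAt_pAlpha_fst (hp : sys.IsRegularPrior) (x : ℝ × ℝ) :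
    HasDerivAt (fun t => sys.pAlpha (t, x.2)) (sys.alphaScore (1, 0) x * sys.pAlpha x) x.1 := by
  rw [alphaScore, fderiv_div_mul_self hp.alpha_nonneg]
  exact (hp.differentiable_alpha x).hasFDerivAt.comp_hasDerivAt x.1
    ((hasDerivAt_id x.1).prodMk (hasDerivAt_const x.1 x.2))

theorem hasDerivAt_pAlpha_snd (hp : sys.IsRegularPrior) (x : ℝ × ℝ) :
    HasDerivAt (fun t => sys.pAlpha (x.1, t)) (sys.alphaScore (0, 1) x * sys.pAlpha x) x.2 := by
  rw [alphaScore, fderiv_div_mul_self hp.alpha_nonneg]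
  exact (hp.differentiable_alpha x).hasFDerivAt.comp_hasDerivAt x.2
    ((hasDerivAt_const x.2 x.1).prodMk (hasDerivAt_id x.2))

theorem hasDerivAt_priorPDF (hp : sys.IsRegularPrior) (i : Fin 3) (ζ : Fin 3 → ℝ) :
    HasDerivAt (fun t => sys.priorPDF (Function.update ζ i t))
      (sys.priorScore i ζ * sys.priorPDF ζ) (ζ i) := by
  fin_cases i
  · have h := (hp.hasDerivAt_pTheta (ζ 0)).mul_const (sys.pAlpha (ζ 1, ζ 2))
    simpa [priorPDF, priorScore, Function.update, mul_assoc] using h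
  · have h := (hp.hasDerivAt_pAlpha_fst (ζ 1, ζ 2)).const_mul (sys.pTheta (ζ 0))
    simpa [priorPDF, priorScore, Function.update, mul_left_comm] using h
  · have h := (hp.hasDerivAt_pAlpha_snd (ζ 1, ζ 2)).const_mul (sys.pTheta (ζ 0))
    simpa [priorPDF, priorScore, Function.update, mul_left_comm] using h

theorem partialDeriv_log_priorPDF (hp : sys.IsRegularPrior) (i : Fin 3) {ζ : Fin 3 → ℝ}
    (hζ : sys.priorPDF ζ ≠ 0) :
    partialDeriv (fun ζ' => Real.log (sys.priorPDF ζ')) i ζ = sys.priorScore i ζ := by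
  have h := (hp.hasDerivAt_priorPDF i ζ).log (by rwa [Function.update_eq_self])
  rw [Function.update_eq_self, mul_div_assoc, div_self hζ, mul_one] at h
  exact h.deriv

theorem fderiv_priorPDF (hp : sys.IsRegularPrior) (ζ x : Fin 3 → ℝ) :
    fderiv ℝ sys.priorPDF ζ x = (∑ i, x i * sys.priorScore i ζ) * sys.priorPDF ζ := by
  have h1 : ∀ i, fderiv ℝ sys.priorPDF ζ (Pi.single i 1) =
      sys.priorScore i ζ * sys.priorPDF ζ := fun i =>
    (hasDerivAt_comp_update hp.differentiable_priorPDF ζ i).unique (hp.hasDerivAt_priorPDF i ζ)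
  conv_lhs => rw [pi_eq_sum_univ' x]
  rw [map_sum, Finset.sum_mul]
  refine Finset.sum_congr rfl fun i _ => ?_
  rw [map_smul, h1, smul_eq_mul, mul_assoc]

theorem measurable_priorPDF (hp : sys.IsRegularPrior) : Measurable sys.priorPDF :=
  hp.differentiable_priorPDF.continuous.measurable

theorem ae_prior_iff (hp : sys.IsRegularPrior) {P : (Fin 3 → ℝ) → Prop} :
    (∀ᵐ ζ ∂sys.prior, P ζ) ↔ ∀ᵐ ζ, sys.priorPDF ζ ≠ 0 → P ζ := by
  have := hp.measurable_priorPDF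
  rw [prior, ae_withDensity_iff (by fun_prop)]
  refine eventually_congr (.of_forall fun ζ => ?_)
  have h0 := hp.priorPDF_nonneg ζ
  rw [Ne, ENNReal.ofReal_eq_zero, h0.ge_iff_eq']

/-- The logarithmic derivatives may differ from the scores only where `p_Z` vanishes, which is a
null set of the prior. -/
theorem fimPrior_eq_integral (hp : sys.IsRegularPrior) (i j : Fin 3) :
    sys.fimPrior i j = ∫ ζ, sys.priorScore i ζ * sys.priorScore j ζ ∂sys.prior := by
  simp only [fimPrior, of_apply]
  refine integral_congr_ae (hp.ae_prior_iff.2 (.of_forall fun ζ hζ => ?_))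
  simp only [hp.partialDeriv_log_priorPDF _ hζ]

theorem memLp_thetaScore (hp : sys.IsRegularPrior) : MemLp sys.thetaScore 2 sys.thetaLaw := by
  refine memLp_two_densityLaw_of_sq hp.measurable_theta hp.theta_nonneg
    (sys.measurable_thetaScore hp.measurable_theta) (hp.theta_info.congr (.of_forall fun θ => ?_))
  exact deriv_log_sq_mul_self (hp.differentiable_theta θ)

theorem memLp_alphaScore_fst (hp : sys.IsRegularPrior) :
    MemLp (sys.alphaScore (1, 0)) 2 sys.alphaLaw := by
  refine memLp_two_densityLaw_of_sq hp.measurable_alpha hp.alpha_nonneg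
    (sys.measurable_alphaScore hp.measurable_alpha _)
    (hp.alpha_infoR.congr (.of_forall fun x => ?_))
  have h := hp.hasDerivAt_pAlpha_fst x
  have h2 := deriv_log_sq_mul_self h.differentiableAt
  rw [h.deriv, alphaScore, fderiv_div_mul_self hp.alpha_nonneg] at h2
  exact h2

theorem memLp_alphaScore_snd (hp : sys.IsRegularPrior) :
    MemLp (sys.alphaScore (0, 1)) 2 sys.alphaLaw := by
  refine memLp_two_densityLaw_of_sq hp.measurable_alpha hp.alpha_nonneg
    (sys.measurable_alphaScore hp.measurable_alpha _)
    (hp.alpha_infoI.congr (.of_forall fun x => ?_))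
  have h := hp.hasDerivAt_pAlpha_snd x
  have h2 := deriv_log_sq_mul_self h.differentiableAt
  rw [h.deriv, alphaScore, fderiv_div_mul_self hp.alpha_nonneg] at h2
  exact h2

theorem memLp_prior_theta (hp : sys.IsRegularPrior) {f : ℝ → ℝ} (hf : Measurable f)
    (h : MemLp f 2 sys.thetaLaw) : MemLp (fun ζ : Fin 3 → ℝ => f (ζ 0)) 2 sys.prior := by
  have := hp.isProbabilityMeasure_alphaLaw
  rw [memLp_two_iff_integrable_sq (Measurable.aestronglyMeasurable (by fun_prop))]
  simpa using hp.integrable_prior_mul h.integrable_sq (integrable_const (1 : ℝ))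

theorem memLp_prior_alpha (hp : sys.IsRegularPrior) {g : ℝ × ℝ → ℝ} (hg : Measurable g)
    (h : MemLp g 2 sys.alphaLaw) : MemLp (fun ζ : Fin 3 → ℝ => g (ζ 1, ζ 2)) 2 sys.prior := by
  have := hp.isProbabilityMeasure_thetaLaw
  rw [memLp_two_iff_integrable_sq (Measurable.aestronglyMeasurable (by fun_prop))]
  simpa using hp.integrable_prior_mul (integrable_const (1 : ℝ)) h.integrable_sq

theorem memLp_priorScore (hp : sys.IsRegularPrior) (i : Fin 3) :
    MemLp (sys.priorScore i) 2 sys.prior := by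
  have h0 := hp.memLp_prior_theta (sys.measurable_thetaScore hp.measurable_theta)
    hp.memLp_thetaScore
  have h1 := hp.memLp_prior_alpha (sys.measurable_alphaScore hp.measurable_alpha _)
    hp.memLp_alphaScore_fst
  have h2 := hp.memLp_prior_alpha (sys.measurable_alphaScore hp.measurable_alpha _)
    hp.memLp_alphaScore_snd
  match i with
  | 0 => exact h0
  | 1 => exact h1
  | 2 => exact h2

/-- `E[p_Θ' / p_Θ] = ∫ p_Θ' = 0`. -/
theorem integral_thetaScore (hp : sys.IsRegularPrior) :
    ∫ θ, sys.thetaScore θ ∂sys.thetaLaw = 0 := by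
  have := hp.isProbabilityMeasure_thetaLaw
  have h1 : Integrable sys.pTheta := by
    by_contra h
    have := hp.integral_theta
    rw [integral_undef h] at this
    exact zero_ne_one this
  have h2 := (integrable_densityLaw_iff hp.measurable_theta hp.theta_nonneg).1
    (hp.memLp_thetaScore.integrable one_le_two)
  simp_rw [smul_eq_mul, mul_comm] at h2
  rw [hp.integral_thetaLaw]
  exact integral_eq_zero_of_hasDerivAt_of_integrable hp.hasDerivAt_pTheta h2 h1

theorem fimPrior_zero_zero (hp : sys.IsRegularPrior) : sys.fimPrior 0 0 = sys.priorInfoTheta := by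
  rw [hp.fimPrior_eq_integral]
  have h := hp.integral_prior_theta fun θ => sys.thetaScore θ * sys.thetaScore θ
  rw [hp.integral_thetaLaw] at h
  refine h.trans (integral_congr_ae (.of_forall fun θ => ?_))
  simp only [deriv_log_sq_mul_self (hp.differentiable_theta θ), thetaScore]
  ring

theorem fimPrior_comm (i j : Fin 3) : sys.fimPrior i j = sys.fimPrior j i := by
  simp only [fimPrior, of_apply, mul_comm]

theorem fimPrior_zero_eq_zero (hp : sys.IsRegularPrior) {k : Fin 3} (hk : k ≠ 0) :
    sys.fimPrior 0 k = 0 := by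
  rw [hp.fimPrior_eq_integral]
  fin_cases k
  · exact absurd rfl hk
  · have h := hp.integral_prior_mul sys.thetaScore (sys.alphaScore (1, 0))
    rw [hp.integral_thetaScore, zero_mul] at h
    exact h
  · have h := hp.integral_prior_mul sys.thetaScore (sys.alphaScore (0, 1))
    rw [hp.integral_thetaScore, zero_mul] at h
    exact h

theorem lintegral_priorPDF (hp : sys.IsRegularPrior) :
    ∫⁻ ζ, ENNReal.ofReal (sys.priorPDF ζ) = 1 := by
  have := hp.isProbabilityMeasure_prior.measure_univ
  rwa [prior, withDensity_apply _ MeasurableSet.univ, setLIntegral_univ] at this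

theorem integral_priorPDF (hp : sys.IsRegularPrior) : ∫ ζ, sys.priorPDF ζ = 1 := by
  rw [integral_eq_lintegral_of_nonneg_ae (.of_forall hp.priorPDF_nonneg)
    hp.measurable_priorPDF.aestronglyMeasurable, hp.lintegral_priorPDF, ENNReal.toReal_one]

/-- A direction carrying no prior information would be one along which the prior density is
constant, which is impossible for an integrable density. -/
theorem fimPrior_posDef (hp : sys.IsRegularPrior) : sys.fimPrior.PosDef := by
  refine PosDef.of_dotProduct_mulVec_pos (IsHermitian.ext fun i j => ?_) fun x hx => ?_
  · rw [star_trivial, fimPrior_comm]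
  have hI : ∀ i j, Integrable (fun ζ => x i * (sys.priorScore i ζ * sys.priorScore j ζ * x j))
      sys.prior := fun i j =>
    (((hp.memLp_priorScore i).integrable_mul (hp.memLp_priorScore j)).mul_const _).const_mul _
  have hquad : star x ⬝ᵥ (sys.fimPrior *ᵥ x) =
      ∫ ζ, (∑ i, x i * sys.priorScore i ζ) ^ 2 ∂sys.prior := by
    have h1 : ∀ ζ, (∑ i, x i * sys.priorScore i ζ) ^ 2 =
        ∑ i, ∑ j, x i * (sys.priorScore i ζ * sys.priorScore j ζ * x j) := by
      intro ζ
      rw [sq, Finset.sum_mul_sum]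
      exact Finset.sum_congr rfl fun i _ => Finset.sum_congr rfl fun j _ => by ring
    simp_rw [h1]
    rw [integral_finsetSum _ fun i _ => integrable_finsetSum _ fun j _ => hI i j]
    simp_rw [integral_finsetSum _ fun j _ => hI _ j, integral_const_mul, integral_mul_const,
      ← hp.fimPrior_eq_integral, dotProduct, mulVec, dotProduct, Finset.mul_sum]
    simp
  rw [hquad]
  refine lt_of_le_of_ne (integral_nonneg fun ζ => sq_nonneg _) fun h0 => ?_
  have hsq : Integrable (fun ζ => (∑ i, x i * sys.priorScore i ζ) ^ 2) sys.prior :=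
    (memLp_finsetSum _ fun i _ => (hp.memLp_priorScore i).const_mul (x i)).integrable_sq
  have hae := (integral_eq_zero_iff_of_nonneg (fun ζ => sq_nonneg _) hsq).1 h0.symm
  have hder : ∀ᵐ ζ, fderiv ℝ sys.priorPDF ζ x = 0 := by
    filter_upwards [hp.ae_prior_iff.1 hae] with ζ hζ
    rw [hp.fderiv_priorPDF]
    by_cases h : sys.priorPDF ζ = 0
    · rw [h, mul_zero]
    · rw [pow_eq_zero_iff two_ne_zero |>.1 (hζ h), zero_mul]
  have hint : Integrable sys.priorPDF := by
    by_contra h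
    have := hp.integral_priorPDF
    rw [integral_undef h] at this
    exact zero_ne_one this
  have := integral_eq_zero_of_fderiv_apply_ae_eq_zero volume hp.differentiable_priorPDF hint hx hder
  rw [hp.integral_priorPDF] at this
  exact one_ne_zero this

end IsRegularPrior

end HybridSystem

/-! ### The bound and its closed form -/

namespace HybridSystem

variable {NT NR NRFT NRFR NS : ℕ} {sys : HybridSystem NT NR NRFT NRFR NS}

theorem pfim_posDef (hp : sys.IsRegularPrior) (hNR : 0 < NR) (hdvd : NRFR ∣ NR)
    (hWH : IsPartiallyConnected sys.WH) (hσ : 0 < sys.noiseVar) (ha : Differentiable ℝ sys.a)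
    (hb : Differentiable ℝ sys.b)
    (hM : ∀ i j, Integrable fun θ => ‖sys.M θ i j‖ ^ 2 * sys.pTheta θ)
    (hMdot : ∀ i j, Integrable fun θ => ‖sys.Mdot θ i j‖ ^ 2 * sys.pTheta θ)
    {L : ℕ} (hL : 0 < L) (S : Matrix (Fin NS) (Fin L) ℂ) : (sys.pfim S).PosDef :=
  PosDef.posSemidef_add (fimObs_posSemidef hp hNR hdvd hWH hσ ha hb hM hMdot hL S)
    hp.fimPrior_posDef

/-- The angle is decoupled from the reflection coefficient in the information matrix. -/
theorem pcrbTheta_eq_one_div (hp : sys.IsRegularPrior) (hNR : 0 < NR) (hdvd : NRFR ∣ NR)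
    (hWH : IsPartiallyConnected sys.WH) (hσ : 0 < sys.noiseVar) (ha : Differentiable ℝ sys.a)
    (hb : Differentiable ℝ sys.b)
    (hM : ∀ i j, Integrable fun θ => ‖sys.M θ i j‖ ^ 2 * sys.pTheta θ)
    (hMdot : ∀ i j, Integrable fun θ => ‖sys.Mdot θ i j‖ ^ 2 * sys.pTheta θ)
    {L : ℕ} (hL : 0 < L) (S : Matrix (Fin NS) (Fin L) ℂ) :
    sys.pcrbTheta S = 1 / sys.pfim S 0 0 := by
  have hpd := pfim_posDef hp hNR hdvd hWH hσ ha hb hM hMdot hL S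
  have h0 : ∀ k, k ≠ 0 → sys.pfim S 0 k = 0 := fun k hk => by
    rw [pfim, Matrix.add_apply, fimObs_zero_eq_zero hp hNR hdvd hWH hσ ha hb hM hMdot S hk,
      hp.fimPrior_zero_eq_zero hk, add_zero]
  have h1 := congrFun (congrFun (mul_nonsing_inv (sys.pfim S)
    ((isUnit_iff_isUnit_det _).1 hpd.isUnit)) 0) 0
  rw [Matrix.mul_apply, Fin.sum_univ_three, h0 1 (by decide), h0 2 (by decide), one_apply_eq,
    zero_mul, zero_mul, add_zero, add_zero] at h1
  rw [pcrbTheta]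
  exact eq_one_div_of_mul_eq_one_right h1

theorem pfim_zero_zero (hp : sys.IsRegularPrior) (hNR : 0 < NR) (hdvd : NRFR ∣ NR)
    (hWH : IsPartiallyConnected sys.WH) (hσ : 0 < sys.noiseVar) (ha : Differentiable ℝ sys.a)
    (hb : Differentiable ℝ sys.b)
    (hMdot : ∀ i j, Integrable fun θ => ‖sys.Mdot θ i j‖ ^ 2 * sys.pTheta θ)
    {L : ℕ} (hL : 0 < L) (S : Matrix (Fin NS) (Fin L) ℂ) :
    sys.pfim S 0 0 = sys.priorInfoTheta + 2 * NRFR * L * sys.gam / (NR * sys.noiseVar) *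
      (sys.A₁ * sys.sampleCov S).trace.re := by
  rw [pfim, Matrix.add_apply, fimObs_zero_zero hp hNR hdvd hWH hσ ha hb hMdot hL,
    hp.fimPrior_zero_zero, add_comm]

theorem pcrbTheta_eq_pcrbFormula (hp : sys.IsRegularPrior) (hNR : 0 < NR) (hdvd : NRFR ∣ NR)
    (hWH : IsPartiallyConnected sys.WH) (hσ : 0 < sys.noiseVar) (ha : Differentiable ℝ sys.a)
    (hb : Differentiable ℝ sys.b)
    (hM : ∀ i j, Integrable fun θ => ‖sys.M θ i j‖ ^ 2 * sys.pTheta θ)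
    (hMdot : ∀ i j, Integrable fun θ => ‖sys.Mdot θ i j‖ ^ 2 * sys.pTheta θ)
    {L : ℕ} (hL : 0 < L) (S : Matrix (Fin NS) (Fin L) ℂ) :
    sys.pcrbTheta S = sys.pcrbFormula L (sys.sampleCov S) := by
  rw [pcrbTheta_eq_one_div hp hNR hdvd hWH hσ ha hb hM hMdot hL,
    pfim_zero_zero hp hNR hdvd hWH hσ ha hb hMdot hL, pcrbFormula]

/-! ### The bound on the mean-squared error -/

theorem measurable_M (ha : Differentiable ℝ sys.a) (hb : Differentiable ℝ sys.b) (i : Fin NR)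
    (j : Fin NT) : Measurable fun θ => sys.M θ i j :=
  (continuous_iff_continuousAt.2 fun θ => (sys.hasDerivAt_M ha hb i j θ).continuousAt).measurable

theorem measurable_Mdot (i : Fin NR) (j : Fin NT) : Measurable fun θ => sys.Mdot θ i j :=
  measurable_deriv fun t => sys.M t i j

theorem measurable_vec_mul_mul {α : Type*} [MeasurableSpace α] {m n k l : Type} [Fintype m]
    [Fintype n] {D : α → Matrix m n ℂ} (hD : ∀ i j, Measurable fun x => D x i j)
    (A : Matrix k m ℂ) (X : Matrix n l ℂ) : Measurable fun x => vec (A * D x * X) := by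
  refine measurable_pi_lambda _ fun i => ?_
  simp only [vec, Matrix.mul_apply]
  fun_prop

theorem measurable_complex_mk : Measurable fun ζ : Fin 3 → ℝ => (⟨ζ 1, ζ 2⟩ : ℂ) := by
  have h : Measurable fun ζ : Fin 3 → ℝ => Complex.measurableEquivRealProd.symm (ζ 1, ζ 2) :=
    Complex.measurableEquivRealProd.symm.measurable.comp
      ((measurable_pi_apply 1).prodMk (measurable_pi_apply 2))
  exact h

theorem measurable_signal (ha : Differentiable ℝ sys.a) (hb : Differentiable ℝ sys.b) {L : ℕ}
    (S : Matrix (Fin NS) (Fin L) ℂ) : Measurable (sys.signal S) :=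
  measurable_complex_mk.smul ((measurable_vec_mul_mul (measurable_M ha hb) sys.WH
    (sys.transmitted S)).comp (measurable_pi_apply 0))

theorem measurable_signalDeriv_zero {L : ℕ} (S : Matrix (Fin NS) (Fin L) ℂ) :
    Measurable (sys.signalDeriv S 0) :=
  measurable_complex_mk.smul ((measurable_vec_mul_mul measurable_Mdot sys.WH
    (sys.transmitted S)).comp (measurable_pi_apply 0))

theorem measurable_likelihood (hNR : 0 < NR) (hdvd : NRFR ∣ NR)
    (hWH : IsPartiallyConnected sys.WH) (hσ : 0 < sys.noiseVar) (ha : Differentiable ℝ sys.a)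
    (hb : Differentiable ℝ sys.b) {L : ℕ} (S : Matrix (Fin NS) (Fin L) ℂ) :
    Measurable fun x : (Fin 3 → ℝ) × (Fin L × Fin NRFR → ℂ) => sys.likelihood S x.1 x.2 := by
  have := measurable_signal ha hb S
  simp_rw [sys.likelihood_eq hNR hdvd hWH hσ]
  fun_prop

theorem measurable_score_zero (ha : Differentiable ℝ sys.a) (hb : Differentiable ℝ sys.b) {L : ℕ}
    (S : Matrix (Fin NS) (Fin L) ℂ) :
    Measurable fun x : (Fin 3 → ℝ) × (Fin L × Fin NRFR → ℂ) => sys.score S 0 x.1 x.2 := by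
  have h1 := measurable_signal ha hb S
  have h2 := measurable_signalDeriv_zero (sys := sys) S
  simp only [score, dotProduct, Pi.sub_apply, Pi.star_apply]
  fun_prop

/-- The parameter `ζ`, out of the angle and the remaining variables. -/
def paramOf {Y : Type} (x : ℝ × ((ℝ × ℝ) × Y)) : Fin 3 → ℝ := ![x.1, x.2.1.1, x.2.1.2]

theorem measurable_paramOf {Y : Type} [MeasurableSpace Y] :
    Measurable (paramOf : ℝ × ((ℝ × ℝ) × Y) → Fin 3 → ℝ) := by
  have : (paramOf : ℝ × ((ℝ × ℝ) × Y) → Fin 3 → ℝ) = fun x => param (x.1, x.2.1) := by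
    funext x; rw [param_apply]; rfl
  rw [this]
  exact param.measurable.comp (by fun_prop)

theorem measurable_paramOf_prodMk {Y : Type} [MeasurableSpace Y] :
    Measurable fun x : ℝ × ((ℝ × ℝ) × Y) => (paramOf x, x.2.2) :=
  measurable_paramOf.prodMk (measurable_snd.comp measurable_snd)

theorem lintegral_mul_lintegral_eq_lintegral_paramOf {Y : Type} [MeasurableSpace Y]
    (ν : Measure Y) [SFinite ν] {π : (Fin 3 → ℝ) → ℝ≥0∞} (hπ : Measurable π)
    {H : (Fin 3 → ℝ) × Y → ℝ≥0∞} (hH : Measurable H) :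
    ∫⁻ ζ, π ζ * ∫⁻ y, H (ζ, y) ∂ν = ∫⁻ x, π (paramOf x) * H (paramOf x, x.2.2)
      ∂((volume : Measure ℝ).prod ((volume : Measure (ℝ × ℝ)).prod ν)) := by
  have h1 : Measurable fun ζ => π ζ * ∫⁻ y, H (ζ, y) ∂ν := hπ.mul hH.lintegral_prod_right'
  have h2 : Measurable fun x : ℝ × ((ℝ × ℝ) × Y) => π (paramOf x) * H (paramOf x, x.2.2) :=
    (hπ.comp measurable_paramOf).mul (hH.comp measurable_paramOf_prodMk)
  have h1' : Measurable fun q => π (param q) * ∫⁻ y, H (param q, y) ∂ν := h1.comp param.measurable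
  rw [← measurePreserving_param.lintegral_comp h1, Measure.volume_eq_prod,
    lintegral_prod _ h1'.aemeasurable, lintegral_prod _ h2.aemeasurable]
  refine lintegral_congr fun θ => ?_
  have h2' : Measurable fun z : (ℝ × ℝ) × Y => π (paramOf (θ, z)) * H (paramOf (θ, z), z.2) :=
    h2.comp measurable_prodMk_left
  rw [lintegral_prod _ h2'.aemeasurable]
  refine lintegral_congr fun a => ?_
  have h3 : Measurable fun y => H (param (θ, a), y) := hH.comp measurable_prodMk_left
  rw [← lintegral_const_mul _ h3, param_apply]
  rfl

/-- The joint density of `θ` and of the pair of `(α_R, α_I)` and `y`. -/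
def jointPDF {L : ℕ} (sys : HybridSystem NT NR NRFT NRFR NS) (S : Matrix (Fin NS) (Fin L) ℂ)
    (x : ℝ × ((ℝ × ℝ) × (Fin L × Fin NRFR → ℂ))) : ℝ :=
  sys.priorPDF (paramOf x) * sys.likelihood S (paramOf x) x.2.2

theorem measurable_jointPDF (hp : sys.IsRegularPrior) (hNR : 0 < NR) (hdvd : NRFR ∣ NR)
    (hWH : IsPartiallyConnected sys.WH) (hσ : 0 < sys.noiseVar) (ha : Differentiable ℝ sys.a)
    (hb : Differentiable ℝ sys.b) {L : ℕ} (S : Matrix (Fin NS) (Fin L) ℂ) :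
    Measurable (sys.jointPDF S) := by
  have h1 := hp.measurable_priorPDF.comp (measurable_paramOf (Y := Fin L × Fin NRFR → ℂ))
  have h2 := (measurable_likelihood hNR hdvd hWH hσ ha hb S).comp measurable_paramOf_prodMk
  exact h1.mul h2

/-- Averages over the prior and the observation are integrals against the joint density. -/
theorem lintegral_prior_obsLaw (hp : sys.IsRegularPrior) (hNR : 0 < NR) (hdvd : NRFR ∣ NR)
    (hWH : IsPartiallyConnected sys.WH) (hσ : 0 < sys.noiseVar) (ha : Differentiable ℝ sys.a)
    (hb : Differentiable ℝ sys.b) {L : ℕ} (S : Matrix (Fin NS) (Fin L) ℂ)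
    {G : (Fin 3 → ℝ) × (Fin L × Fin NRFR → ℂ) → ℝ} (hG : Measurable G) :
    ∫⁻ ζ, ∫⁻ y, ENNReal.ofReal (G (ζ, y)) ∂(sys.obsLaw S ζ) ∂sys.prior =
      ∫⁻ x, ENNReal.ofReal (G (paramOf x, x.2.2) * sys.jointPDF S x)
        ∂((volume : Measure ℝ).prod ((volume : Measure (ℝ × ℝ)).prod
          (volume : Measure (Fin L × Fin NRFR → ℂ)))) := by
  have hl := (measurable_likelihood hNR hdvd hWH hσ ha hb S).ennreal_ofReal
  have hpm := hp.measurable_priorPDF.ennreal_ofReal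
  set H : (Fin 3 → ℝ) × (Fin L × Fin NRFR → ℂ) → ℝ≥0∞ := fun x =>
    ENNReal.ofReal (sys.likelihood S x.1 x.2) * ENNReal.ofReal (G x) with hHdef
  have hH : Measurable H := hl.mul hG.ennreal_ofReal
  have hin : ∀ ζ, ∫⁻ y, ENNReal.ofReal (G (ζ, y)) ∂(sys.obsLaw S ζ) = ∫⁻ y, H (ζ, y) := by
    intro ζ
    rw [sys.obsLaw_eq_withDensity hNR hdvd hWH hσ]
    have hζ : Measurable (Prod.mk ζ : (Fin L × Fin NRFR → ℂ) → _) := measurable_prodMk_left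
    have h1 := hl.comp hζ
    have h2 := hG.ennreal_ofReal.comp hζ
    exact lintegral_withDensity_eq_lintegral_mul volume h1 h2
  simp_rw [hin]
  have hinm : Measurable fun ζ => ∫⁻ y, H (ζ, y) := hH.lintegral_prod_right'
  rw [prior, lintegral_withDensity_eq_lintegral_mul _ hpm hinm]
  simp only [Pi.mul_apply]
  rw [lintegral_mul_lintegral_eq_lintegral_paramOf volume hpm hH]
  refine lintegral_congr fun x => ?_
  have hl0 := (sys.likelihood_pos hNR hdvd hWH hσ S (paramOf x) x.2.2).le
  simp only [hHdef]
  rw [← ENNReal.ofReal_mul hl0, ← ENNReal.ofReal_mul (hp.priorPDF_nonneg _), jointPDF,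
    mul_comm (G _), mul_assoc]

theorem isProbabilityMeasure_obsLaw (hdvd : NRFR ∣ NR) (hWH : IsPartiallyConnected sys.WH)
    (hσ : 0 < sys.noiseVar) {L : ℕ} (S : Matrix (Fin NS) (Fin L) ℂ) (ζ : Fin 3 → ℝ) :
    IsProbabilityMeasure (sys.obsLaw S ζ) := by
  rw [sys.obsLaw_eq_map hdvd hWH hσ]
  exact Measure.isProbabilityMeasure_map (measurable_const_add _).aemeasurable

/-- The score of the observation is centred given the parameter, so that the two scores in the
angle are uncorrelated and their information adds up. -/
theorem lintegral_score_add_thetaScore_sq (hp : sys.IsRegularPrior) (hNR : 0 < NR)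
    (hdvd : NRFR ∣ NR) (hWH : IsPartiallyConnected sys.WH) (hσ : 0 < sys.noiseVar)
    (ha : Differentiable ℝ sys.a) (hb : Differentiable ℝ sys.b)
    (hMdot : ∀ i j, Integrable fun θ => ‖sys.Mdot θ i j‖ ^ 2 * sys.pTheta θ)
    {L : ℕ} (S : Matrix (Fin NS) (Fin L) ℂ) :
    ∫⁻ ζ, ∫⁻ y, ENNReal.ofReal ((sys.score S 0 ζ y + sys.thetaScore (ζ 0)) ^ 2)
      ∂(sys.obsLaw S ζ) ∂sys.prior = ENNReal.ofReal (sys.pfim S 0 0) := by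
  have hc := sys.combVar_pos hNR hdvd hσ
  have hin : ∀ ζ, ∫⁻ y, ENNReal.ofReal ((sys.score S 0 ζ y + sys.thetaScore (ζ 0)) ^ 2)
      ∂(sys.obsLaw S ζ) = ENNReal.ofReal (2 / sys.combVar *
        (star (sys.signalDeriv S 0 ζ) ⬝ᵥ sys.signalDeriv S 0 ζ).re +
        sys.thetaScore (ζ 0) * sys.thetaScore (ζ 0)) := by
    intro ζ
    have := isProbabilityMeasure_obsLaw hdvd hWH hσ S ζ
    have hs := sys.memLp_score hdvd hWH hσ S 0 ζ
    have hss : Integrable (fun y => sys.score S 0 ζ y * sys.score S 0 ζ y) (sys.obsLaw S ζ) :=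
      hs.integrable_mul hs
    have hs1 : Integrable (fun y => 2 * sys.thetaScore (ζ 0) * sys.score S 0 ζ y)
        (sys.obsLaw S ζ) := (hs.integrable one_le_two).const_mul _
    have hs2 : Integrable (fun y => 2 * sys.thetaScore (ζ 0) * sys.score S 0 ζ y +
        sys.thetaScore (ζ 0) * sys.thetaScore (ζ 0)) (sys.obsLaw S ζ) :=
      hs1.add (integrable_const _)
    have h2 : ∀ y, (sys.score S 0 ζ y + sys.thetaScore (ζ 0)) ^ 2 =
        sys.score S 0 ζ y * sys.score S 0 ζ y + (2 * sys.thetaScore (ζ 0) * sys.score S 0 ζ y +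
          sys.thetaScore (ζ 0) * sys.thetaScore (ζ 0)) := fun y => by ring
    rw [← ofReal_integral_eq_lintegral_ofReal ((hss.add hs2).congr (.of_forall fun y =>
      (h2 y).symm)) (.of_forall fun y => sq_nonneg _)]
    simp_rw [h2]
    rw [integral_add hss hs2, integral_add hs1 (integrable_const _),
      sys.integral_score_mul_score hNR hdvd hWH hσ, integral_const_mul,
      sys.integral_score hdvd hWH hσ]
    simp
  simp_rw [hin]
  have hI1 : Integrable (fun ζ => 2 / sys.combVar *
      (star (sys.signalDeriv S 0 ζ) ⬝ᵥ sys.signalDeriv S 0 ζ).re) sys.prior := by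
    refine Integrable.const_mul ?_ _
    simp only [signalDeriv, cons_val_zero, re_star_smul_dotProduct_smul]
    have h1 := memLp_vec_mul_mul (hp.memLp_Mdot hMdot) sys.WH (sys.transmitted S)
    have h2 : Integrable (fun x : ℝ × ℝ => x.1 ^ 2 + x.2 ^ 2) sys.alphaLaw :=
      hp.memLp_alpha_re.integrable_sq.add hp.memLp_alpha_im.integrable_sq
    have h3 := hp.integrable_prior_mul (f := fun θ => (star (vec (sys.WH * sys.Mdot θ *
      sys.transmitted S)) ⬝ᵥ vec (sys.WH * sys.Mdot θ * sys.transmitted S)).re)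
      (integrable_star_dotProduct h1 h1).re h2
    exact h3
  have hI2 : Integrable (fun ζ : Fin 3 → ℝ => sys.thetaScore (ζ 0) * sys.thetaScore (ζ 0))
      sys.prior := (hp.memLp_priorScore 0).integrable_mul (hp.memLp_priorScore 0)
  have hI : Integrable (fun ζ => 2 / sys.combVar *
      (star (sys.signalDeriv S 0 ζ) ⬝ᵥ sys.signalDeriv S 0 ζ).re +
      sys.thetaScore (ζ 0) * sys.thetaScore (ζ 0)) sys.prior := hI1.add hI2
  rw [← ofReal_integral_eq_lintegral_ofReal hI, integral_add hI1 hI2,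
    ← sys.fimObs_eq_integral hNR hdvd hWH hσ ha hb, pfim, Matrix.add_apply, hp.fimPrior_eq_integral]
  · rfl
  · refine .of_forall fun ζ => add_nonneg (mul_nonneg (by positivity) ?_) (mul_self_nonneg _)
    rw [← sum_norm_sq_eq_re_star_dotProduct]
    positivity

theorem hasDerivAt_jointPDF (hp : sys.IsRegularPrior) (hNR : 0 < NR) (hdvd : NRFR ∣ NR)
    (hWH : IsPartiallyConnected sys.WH) (hσ : 0 < sys.noiseVar) (ha : Differentiable ℝ sys.a)
    (hb : Differentiable ℝ sys.b) {L : ℕ} (S : Matrix (Fin NS) (Fin L) ℂ)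
    (w : (ℝ × ℝ) × (Fin L × Fin NRFR → ℂ)) (θ : ℝ) :
    HasDerivAt (fun t => sys.jointPDF S (t, w))
      ((sys.score S 0 (paramOf (θ, w)) w.2 + sys.thetaScore θ) * sys.jointPDF S (θ, w)) θ := by
  have hup : ∀ t, Function.update (paramOf (θ, w)) 0 t = paramOf (t, w) := by
    intro t
    ext i
    fin_cases i <;> simp [paramOf]
  have h1 := hp.hasDerivAt_priorPDF 0 (paramOf (θ, w))
  have h2 := sys.hasDerivAt_likelihood hNR hdvd hWH hσ ha hb S 0 (paramOf (θ, w)) w.2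
  simp_rw [hup] at h1 h2
  refine (h1.mul h2).congr_deriv ?_
  have h3 : sys.priorScore 0 (paramOf (θ, w)) = sys.thetaScore θ := rfl
  have h4 : paramOf (θ, w) 0 = θ := rfl
  rw [h3, h4, jointPDF]
  ring

/-- As the information matrix decouples, `van_trees` for the angle alone already gives the bound. -/
theorem ofReal_pcrbTheta_le_mse (hp : sys.IsRegularPrior) (hNR : 0 < NR) (hdvd : NRFR ∣ NR)
    (hWH : IsPartiallyConnected sys.WH) (hσ : 0 < sys.noiseVar) (ha : Differentiable ℝ sys.a)
    (hb : Differentiable ℝ sys.b)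
    (hM : ∀ i j, Integrable fun θ => ‖sys.M θ i j‖ ^ 2 * sys.pTheta θ)
    (hMdot : ∀ i j, Integrable fun θ => ‖sys.Mdot θ i j‖ ^ 2 * sys.pTheta θ)
    {L : ℕ} (hL : 0 < L) (S : Matrix (Fin NS) (Fin L) ℂ)
    {est : (Fin L × Fin NRFR → ℂ) → ℝ} (hest : Measurable est) :
    ENNReal.ofReal (sys.pcrbTheta S) ≤ sys.mse S est := by
  have hJ : 0 < sys.pfim S 0 0 :=
    (pfim_posDef hp hNR hdvd hWH hσ ha hb hM hMdot hL S).diag_pos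
  by_cases htop : sys.mse S est = ∞
  · rw [htop]; exact le_top
  have hθ := sys.measurable_thetaScore hp.measurable_theta
  have hsc := measurable_score_zero ha hb S
  have hmse := lintegral_prior_obsLaw hp hNR hdvd hWH hσ ha hb S
    (G := fun x => (est x.2 - x.1 0) ^ 2) (by fun_prop)
  have hinfo := lintegral_prior_obsLaw hp hNR hdvd hWH hσ ha hb S
    (G := fun x => (sys.score S 0 x.1 x.2 + sys.thetaScore (x.1 0)) ^ 2) (by fun_prop)
  have hone := lintegral_prior_obsLaw hp hNR hdvd hWH hσ ha hb S
    (G := fun _ => 1) (by fun_prop)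
  have := hp.isProbabilityMeasure_prior
  have hprob := isProbabilityMeasure_obsLaw hdvd hWH hσ S
  simp only [ENNReal.ofReal_one, one_mul, lintegral_one, measure_univ] at hone
  rw [lintegral_score_add_thetaScore_sq hp hNR hdvd hWH hσ ha hb hMdot S] at hinfo
  change sys.mse S est = _ at hmse
  rw [pcrbTheta_eq_one_div hp hNR hdvd hWH hσ ha hb hM hMdot hL, ENNReal.ofReal_div_of_pos hJ,
    ENNReal.ofReal_one]
  refine ENNReal.div_le_of_le_mul' ?_
  have hψ : Measurable fun x : ℝ × ((ℝ × ℝ) × (Fin L × Fin NRFR → ℂ)) =>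
      sys.score S 0 (paramOf x) x.2.2 + sys.thetaScore x.1 :=
    (hsc.comp (measurable_paramOf.prodMk (by fun_prop))).add (hθ.comp measurable_fst)
  rw [hmse]
  rw [hmse] at htop
  exact van_trees _ (measurable_jointPDF hp hNR hdvd hWH hσ ha hb S) hψ
    (fun x => mul_nonneg (hp.priorPDF_nonneg _) (sys.likelihood_pos hNR hdvd hWH hσ S _ _).le)
    (hasDerivAt_jointPDF hp hNR hdvd hWH hσ ha hb S) hone.symm (T := fun w => est w.2)
    (by fun_prop) hJ.le hinfo.ge htop

end HybridSystem

/-! ### Long blocks of Gaussian symbols -/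

/-- `z_k conj(z_m)` in terms of real-linear functionals of `z`: with `e` the standard basis,
`Re z_k = Re(e_kᴴ z)` and `Im z_k = Re((j e_k)ᴴ z)`. -/
theorem mul_star_eq_re_star_dotProduct {ι : Type} [Fintype ι] [DecidableEq ι] (k m : ι)
    (v : ι → ℂ) : v k * star (v m) =
      (((star (Pi.single k 1 : ι → ℂ) ⬝ᵥ v).re * (star (Pi.single m 1 : ι → ℂ) ⬝ᵥ v).re +
        (star (Pi.single k Complex.I : ι → ℂ) ⬝ᵥ v).re *
          (star (Pi.single m Complex.I : ι → ℂ) ⬝ᵥ v).re : ℝ) : ℂ) +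
      (((star (Pi.single k Complex.I : ι → ℂ) ⬝ᵥ v).re *
          (star (Pi.single m 1 : ι → ℂ) ⬝ᵥ v).re -
        (star (Pi.single k 1 : ι → ℂ) ⬝ᵥ v).re *
          (star (Pi.single m Complex.I : ι → ℂ) ⬝ᵥ v).re : ℝ) : ℂ) * Complex.I := by
  simp only [Pi.star_single, single_dotProduct]
  apply Complex.ext
  · simp
  · simp; ring

theorem integrable_mul_star_whiteCSCG (ι : Type) [Fintype ι] (v : ℝ≥0) (k m : ι) :
    Integrable (fun z => z k * star (z m)) (whiteCSCG ι v) := by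
  classical
  have h : ∀ γ δ : ι → ℂ, Integrable (fun z => (star γ ⬝ᵥ z).re * (star δ ⬝ᵥ z).re)
      (whiteCSCG ι v) := fun γ δ =>
    (memLp_re_star_dotProduct_whiteCSCG v γ).integrable_mul (memLp_re_star_dotProduct_whiteCSCG v δ)
  simp_rw [mul_star_eq_re_star_dotProduct]
  exact ((h _ _).add (h _ _)).ofReal.add (((h _ _).sub (h _ _)).ofReal.mul_const _)

theorem integral_mul_star_whiteCSCG (ι : Type) [Fintype ι] [DecidableEq ι] (v : ℝ≥0) (k m : ι) :
    ∫ z, z k * star (z m) ∂(whiteCSCG ι v) = if k = m then (v : ℂ) else 0 := by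
  have h : ∀ γ δ : ι → ℂ, Integrable (fun z => (star γ ⬝ᵥ z).re * (star δ ⬝ᵥ z).re)
      (whiteCSCG ι v) := fun γ δ =>
    (memLp_re_star_dotProduct_whiteCSCG v γ).integrable_mul (memLp_re_star_dotProduct_whiteCSCG v δ)
  have h1 : ∀ a b c d : ι → ℂ, Integrable (fun z => (((star a ⬝ᵥ z).re * (star b ⬝ᵥ z).re +
      (star c ⬝ᵥ z).re * (star d ⬝ᵥ z).re : ℝ) : ℂ)) (whiteCSCG ι v) := fun a b c d =>
    ((h a b).add (h c d)).ofReal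
  have h2 : ∀ a b c d : ι → ℂ, Integrable (fun z => (((star a ⬝ᵥ z).re * (star b ⬝ᵥ z).re -
      (star c ⬝ᵥ z).re * (star d ⬝ᵥ z).re : ℝ) : ℂ) * Complex.I) (whiteCSCG ι v) :=
    fun a b c d => ((h a b).sub (h c d)).ofReal.mul_const _
  simp_rw [mul_star_eq_re_star_dotProduct]
  rw [integral_add (h1 _ _ _ _) (h2 _ _ _ _), integral_mul_const, integral_complex_ofReal,
    integral_complex_ofReal, integral_add (h _ _) (h _ _), integral_sub (h _ _) (h _ _)]
  simp_rw [integral_re_star_dotProduct_mul_whiteCSCG]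
  by_cases hkm : k = m
  · subst hkm
    apply Complex.ext <;> simp [Pi.star_single]
  · simp [Pi.star_single, hkm, Ne.symm hkm]

/-- The law of large numbers for the empirical second moments of white Gaussian vectors. -/
theorem ae_tendsto_empirical_second_moment {ι : Type} [Fintype ι] [DecidableEq ι] {Ω : Type*}
    [MeasurableSpace Ω] {P : Measure Ω} [IsProbabilityMeasure P] {s : ℕ → Ω → ι → ℂ}
    (hindep : iIndepFun s P) (hlaw : ∀ l, HasLaw (s l) (whiteCSCG ι 1) P) :
    ∀ᵐ ω ∂P, ∀ k m, Tendsto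
      (fun L : ℕ => (L : ℂ)⁻¹ * ∑ l ∈ Finset.range L, s l ω k * star (s l ω m)) atTop
      (𝓝 ((1 : Matrix ι ι ℂ) k m)) := by
  rw [ae_all_iff]
  intro k
  rw [ae_all_iff]
  intro m
  have hg : Measurable fun z : ι → ℂ => z k * star (z m) := by fun_prop
  have h0 := (hlaw 0).integral_comp (f := fun z : ι → ℂ => z k * star (z m))
    hg.aestronglyMeasurable
  have hint : Integrable (fun ω => s 0 ω k * star (s 0 ω m)) P := by
    have h1 := integrable_mul_star_whiteCSCG ι 1 k m
    rw [← (hlaw 0).map_eq] at h1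
    exact (integrable_map_measure hg.aestronglyMeasurable (hlaw 0).aemeasurable).1 h1
  have hslln := strong_law_ae (μ := P) (fun l ω => s l ω k * star (s l ω m)) hint
    (fun i j hij => (hindep.indepFun hij).comp hg hg)
    (fun i => ((hlaw i).identDistrib (hlaw 0)).comp hg)
  have h2 : ∫ ω, s 0 ω k * star (s 0 ω m) ∂P = (1 : Matrix ι ι ℂ) k m := by
    refine h0.trans ?_
    rw [integral_mul_star_whiteCSCG, one_apply]
    simp
  filter_upwards [hslln] with ω hω
  rw [h2] at hω
  refine hω.congr fun L => ?_
  rw [Complex.real_smul]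
  push_cast
  rfl

namespace HybridSystem

variable {NT NR NRFT NRFR NS : ℕ} {sys : HybridSystem NT NR NRFT NRFR NS}

theorem sampleCov_eq_mul {L : ℕ} (S : Matrix (Fin NS) (Fin L) ℂ) : sys.sampleCov S =
    sys.VRF * sys.VBB * ((L : ℂ)⁻¹ • (S * Sᴴ)) * (sys.VRF * sys.VBB)ᴴ := by
  rw [sampleCov_eq, transmitted, conjTranspose_mul (sys.VRF * sys.VBB) S]
  simp only [Matrix.mul_smul, Matrix.smul_mul, Matrix.mul_assoc]

theorem VRF_mul_RBB_mul : sys.VRF * sys.RBB * sys.VRFᴴ =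
    sys.VRF * sys.VBB * (sys.VRF * sys.VBB)ᴴ := by
  simp only [RBB, conjTranspose_mul, Matrix.mul_assoc]

theorem tendsto_sampleCov {s : ℕ → Fin NS → ℂ}
    (hs : ∀ k m, Tendsto (fun L : ℕ => (L : ℂ)⁻¹ * ∑ l ∈ Finset.range L, s l k * star (s l m))
      atTop (𝓝 ((1 : Matrix (Fin NS) (Fin NS) ℂ) k m))) :
    Tendsto (fun L : ℕ => sys.sampleCov (Matrix.of fun k (l : Fin L) => s l k)) atTop
      (𝓝 (sys.VRF * sys.RBB * sys.VRFᴴ)) := by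
  have h1 : Tendsto (fun L : ℕ => (L : ℂ)⁻¹ • ((Matrix.of fun k (l : Fin L) => s l k) *
      (Matrix.of fun k (l : Fin L) => s l k)ᴴ)) atTop (𝓝 (1 : Matrix (Fin NS) (Fin NS) ℂ)) := by
    refine tendsto_pi_nhds.2 fun k => tendsto_pi_nhds.2 fun m => (hs k m).congr fun L => ?_
    rw [Matrix.smul_apply, Matrix.mul_apply, smul_eq_mul, ← Fin.sum_univ_eq_sum_range
      (fun l => s l k * star (s l m))]
    rfl
  have hcont : Continuous fun Z : Matrix (Fin NS) (Fin NS) ℂ =>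
      sys.VRF * sys.VBB * Z * (sys.VRF * sys.VBB)ᴴ := by fun_prop
  have h2 := (hcont.tendsto 1).comp h1
  rw [Matrix.mul_one, ← VRF_mul_RBB_mul] at h2
  refine h2.congr fun L => ?_
  rw [sampleCov_eq_mul]
  rfl

/-- If the transmit covariance carries no information on the angle, then neither does any block of
symbols. -/
theorem re_trace_mul_sampleCov_eq_zero (hp : sys.IsRegularPrior)
    (hMdot : ∀ i j, Integrable fun θ => ‖sys.Mdot θ i j‖ ^ 2 * sys.pTheta θ)
    (h0 : (sys.A₁ * (sys.VRF * sys.RBB * sys.VRFᴴ)).trace.re = 0) {L : ℕ} (hL : 0 < L)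
    (S : Matrix (Fin NS) (Fin L) ℂ) : (sys.A₁ * sys.sampleCov S).trace.re = 0 := by
  have hL' : (L : ℝ) ≠ 0 := by exact_mod_cast hL.ne'
  rw [VRF_mul_RBB_mul, A₁, hp.re_trace_gram_mul (hp.memLp_Mdot hMdot)] at h0
  have hm := memLp_vec_mul_mul (hp.memLp_Mdot hMdot) sys.WH (sys.VRF * sys.VBB)
  have hmi : Integrable (fun θ => (star (vec (sys.WH * sys.Mdot θ * (sys.VRF * sys.VBB))) ⬝ᵥ
      vec (sys.WH * sys.Mdot θ * (sys.VRF * sys.VBB))).re) sys.thetaLaw :=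
    (integrable_star_dotProduct hm hm).re
  have hae := (integral_eq_zero_iff_of_nonneg (fun θ => by
    simp only [Pi.zero_apply]
    rw [← sum_norm_sq_eq_re_star_dotProduct]; positivity) hmi).1 h0
  have h1 : (L : ℝ) * (sys.A₁ * sys.sampleCov S).trace.re = 0 := by
    rw [sys.natCast_mul_re_trace_mul_sampleCov hL, A₁, hp.re_trace_gram_mul (hp.memLp_Mdot hMdot)]
    refine integral_eq_zero_of_ae ?_
    filter_upwards [hae] with θ hθ
    -- the transmitted block factors through `V_RF V_BB`, which `W_RFᴴ Ṁ(θ)` annihilates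
    have hz : sys.WH * sys.Mdot θ * (sys.VRF * sys.VBB) = 0 := by
      rw [Pi.zero_apply, ← sum_norm_sq_eq_re_star_dotProduct,
        Finset.sum_eq_zero_iff_of_nonneg fun _ _ => by positivity] at hθ
      rw [← vec_eq_zero_iff]
      ext k : 1
      simpa using hθ k (Finset.mem_univ k)
    rw [transmitted, ← Matrix.mul_assoc, hz]
    simp
  exact (mul_eq_zero.1 h1).resolve_left hL'

/-- The ratio of the bounds. If `K t ≠ 0` both information terms grow linearly in `L` and the prior
information `I` is negligible; otherwise only `I` is left in both. -/
theorem tendsto_info_ratio {I K t : ℝ} {τ : ℕ → ℝ} (hI : 0 < I) (hτ : Tendsto τ atTop (𝓝 t))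
    (h0 : t = 0 → ∀ L, 0 < L → τ L = 0) :
    Tendsto (fun L : ℕ => (1 / (I + K * L * τ L)) / (1 / (I + K * L * t))) atTop (𝓝 1) := by
  by_cases hKt : K * t = 0
  · refine tendsto_const_nhds.congr' ?_
    filter_upwards [eventually_gt_atTop 0] with L hL
    rcases mul_eq_zero.1 hKt with hK | ht
    · simp [hK, hI.ne']
    · simp [h0 ht L hL, ht, hI.ne']
  · have hinv : Tendsto (fun L : ℕ => I / (L : ℝ)) atTop (𝓝 0) :=
      tendsto_const_div_atTop_nhds_zero_nat I
    have h1 : Tendsto (fun L : ℕ => (I / L + K * t) / (I / L + K * τ L)) atTop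
        (𝓝 ((0 + K * t) / (0 + K * t))) :=
      (hinv.add_const _).div (hinv.add (hτ.const_mul K)) (by simpa using hKt)
    rw [zero_add, div_self hKt] at h1
    refine h1.congr' ?_
    filter_upwards [eventually_gt_atTop 0] with L hL
    have hL' : (L : ℝ) ≠ 0 := by exact_mod_cast hL.ne'
    have h2 : ∀ z, I / L + K * z = (I + K * L * z) / L := fun z => by field_simp
    rw [h2, h2, div_div_div_cancel_right₀ hL', one_div, one_div, inv_div_inv]

theorem tendsto_pcrbTheta_div (hp : sys.IsRegularPrior) (hNR : 0 < NR) (hdvd : NRFR ∣ NR)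
    (hWH : IsPartiallyConnected sys.WH) (hσ : 0 < sys.noiseVar) (ha : Differentiable ℝ sys.a)
    (hb : Differentiable ℝ sys.b)
    (hM : ∀ i j, Integrable fun θ => ‖sys.M θ i j‖ ^ 2 * sys.pTheta θ)
    (hMdot : ∀ i j, Integrable fun θ => ‖sys.Mdot θ i j‖ ^ 2 * sys.pTheta θ)
    {S : ∀ L : ℕ, Matrix (Fin NS) (Fin L) ℂ}
    (hS : Tendsto (fun L => sys.sampleCov (S L)) atTop (𝓝 (sys.VRF * sys.RBB * sys.VRFᴴ))) :
    Tendsto (fun L : ℕ => sys.pcrbTheta (S L) / sys.pcrbFormula L (sys.VRF * sys.RBB * sys.VRFᴴ))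
      atTop (𝓝 1) := by
  have hI : 0 < sys.priorInfoTheta := by
    rw [← hp.fimPrior_zero_zero]; exact hp.fimPrior_posDef.diag_pos
  have hcont : Continuous fun R : Matrix (Fin NT) (Fin NT) ℂ => (sys.A₁ * R).trace.re :=
    Complex.continuous_re.comp (by fun_prop)
  have h := tendsto_info_ratio (K := 2 * NRFR * sys.gam / (NR * sys.noiseVar)) hI
    ((hcont.tendsto _).comp hS)
    fun h0 L hL => re_trace_mul_sampleCov_eq_zero hp hMdot h0 hL (S L)
  refine h.congr' ?_
  filter_upwards [eventually_gt_atTop 0] with L hL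
  rw [pcrbTheta_eq_pcrbFormula hp hNR hdvd hWH hσ ha hb hM hMdot hL, pcrbFormula, pcrbFormula]
  have h2 : 2 * (NRFR : ℝ) * L * sys.gam / (NR * sys.noiseVar) =
      2 * NRFR * sys.gam / (NR * sys.noiseVar) * L := by ring
  rw [h2]
  rfl

end HybridSystem

end

/-! ### The posterior Cramér-Rao bound -/

theorem mainTheorem1 {NT NR NRFT NRFR NS : ℕ} (sys : HybridSystem NT NR NRFT NRFR NS)
    -- partially-connected receive array
    (hNR : 0 < NR) (hdvd : NRFR ∣ NR) (hWH : IsPartiallyConnected sys.WH)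
    (hσ : 0 < sys.noiseVar)
    -- steering vectors
    (ha : Differentiable ℝ sys.a) (hb : Differentiable ℝ sys.b)
    (hM : ∀ i j, Integrable fun θ => ‖sys.M θ i j‖ ^ 2 * sys.pTheta θ)
    (hMdot : ∀ i j, Integrable fun θ => ‖sys.Mdot θ i j‖ ^ 2 * sys.pTheta θ)
    -- prior density of the angle, with finite Fisher information
    (hθ_nonneg : ∀ θ, 0 ≤ sys.pTheta θ) (hθ_one : ∫ θ, sys.pTheta θ = 1)
    (hθ_diff : Differentiable ℝ sys.pTheta)
    (hθ_info : Integrable fun θ =>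
      (deriv (fun t => Real.log (sys.pTheta t)) θ) ^ 2 * sys.pTheta θ)
    -- prior density of the reflection coefficient, with finite Fisher information,
    -- zero mean and finite second moment
    (hα_nonneg : ∀ x, 0 ≤ sys.pAlpha x) (hα_one : ∫ x, sys.pAlpha x = 1)
    (hα_diff : Differentiable ℝ sys.pAlpha)
    (hα_infoR : Integrable fun x : ℝ × ℝ =>
      (deriv (fun t => Real.log (sys.pAlpha (t, x.2))) x.1) ^ 2 * sys.pAlpha x)
    (hα_infoI : Integrable fun x : ℝ × ℝ =>
      (deriv (fun t => Real.log (sys.pAlpha (x.1, t))) x.2) ^ 2 * sys.pAlpha x)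
    (hα_sq : Integrable fun x : ℝ × ℝ => (x.1 ^ 2 + x.2 ^ 2) * sys.pAlpha x)
    (hα_meanR : ∫ x : ℝ × ℝ, x.1 * sys.pAlpha x = 0)
    (hα_meanI : ∫ x : ℝ × ℝ, x.2 * sys.pAlpha x = 0) :
    -- for every block of known symbols
    (∀ (L : ℕ), 0 < L → ∀ S : Matrix (Fin NS) (Fin L) ℂ,
      -- the noise stays white after analog combining, and `y ∼ CN(u, C_y)` given `ζ`
      sys.noiseCov L = (((NR : ℝ) / NRFR * sys.noiseVar : ℝ) : ℂ) • 1 ∧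
      (∀ ζ, sys.obsLaw S ζ = volume.withDensity fun y => ENNReal.ofReal (sys.likelihood S ζ y)) ∧
      -- the observation Fisher information matrix and its blocks
      (∀ i j, sys.fimObs S i j = 2 * ∫ ζ, (star (partialDeriv (sys.signal S) i ζ) ⬝ᵥ
        ((sys.noiseCov L)⁻¹ *ᵥ partialDeriv (sys.signal S) j ζ)).re ∂sys.prior) ∧
      sys.fimObs S 0 0 = 2 * NRFR * L * sys.gam / (NR * sys.noiseVar) *
        (sys.A₁ * sys.sampleCov S).trace.re ∧
      (∀ k, k ≠ 0 → sys.fimObs S 0 k = 0 ∧ sys.fimObs S k 0 = 0) ∧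
      (∀ k m, k ≠ 0 → m ≠ 0 → sys.fimObs S k m =
        if k = m then 2 * NRFR * L / (NR * sys.noiseVar) *
          (sys.A₂ * sys.sampleCov S).trace.re else 0) ∧
      -- the bound exists and has the closed form, with the sample covariance in general
      -- and with the transmit covariance once the two agree
      (sys.pfim S).PosDef ∧
      sys.pcrbTheta S = sys.pcrbFormula L (sys.sampleCov S) ∧
      (sys.sampleCov S = sys.VRF * sys.RBB * sys.VRFᴴ →
        sys.pcrbTheta S = sys.pcrbFormula L (sys.VRF * sys.RBB * sys.VRFᴴ)) ∧
      -- it bounds the MSE of every processing of the combined signal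
      (∀ est : (Fin L × Fin NRFR → ℂ) → ℝ, Measurable est →
        ENNReal.ofReal (sys.pcrbTheta S) ≤ sys.mse S est)) ∧
    -- large `L`: for i.i.d. `CN(0, I)` symbols, almost surely the sample covariance converges to
    -- the transmit covariance and the bound is asymptotic to the closed form
    (∀ (Ω : Type*) [MeasurableSpace Ω] (P : Measure Ω) [IsProbabilityMeasure P]
      (s : ℕ → Ω → Fin NS → ℂ), iIndepFun s P →
      (∀ l, HasLaw (s l) (whiteCSCG (Fin NS) 1) P) →
      ∀ᵐ ω ∂P,
        (∀ i j, Tendsto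
          (fun L : ℕ => sys.sampleCov (Matrix.of fun k (l : Fin L) => s l ω k) i j) atTop
          (𝓝 ((sys.VRF * sys.RBB * sys.VRFᴴ) i j))) ∧
        Tendsto
          (fun L : ℕ => sys.pcrbTheta (Matrix.of fun k (l : Fin L) => s l ω k) /
            sys.pcrbFormula L (sys.VRF * sys.RBB * sys.VRFᴴ)) atTop (𝓝 1)) := by
  have hp : sys.IsRegularPrior := ⟨hθ_nonneg, hθ_one, hθ_diff, hθ_info, hα_nonneg, hα_one, hα_diff,
    hα_infoR, hα_infoI, hα_sq, hα_meanR, hα_meanI⟩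
  refine ⟨fun L hL S => ⟨sys.noiseCov_eq hNR hdvd hWH L,
    sys.obsLaw_eq_withDensity hNR hdvd hWH hσ S,
    sys.fimObs_eq_two_mul_integral hNR hdvd hWH hσ ha hb S,
    HybridSystem.fimObs_zero_zero hp hNR hdvd hWH hσ ha hb hMdot hL S, fun k hk => ?_,
    fun k m hk hm => HybridSystem.fimObs_alpha hp hNR hdvd hWH hσ ha hb hM hL S hk hm,
    HybridSystem.pfim_posDef hp hNR hdvd hWH hσ ha hb hM hMdot hL S,
    HybridSystem.pcrbTheta_eq_pcrbFormula hp hNR hdvd hWH hσ ha hb hM hMdot hL S, fun hS => ?_,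
    fun est hest =>
      HybridSystem.ofReal_pcrbTheta_le_mse hp hNR hdvd hWH hσ ha hb hM hMdot hL S hest⟩,
    fun Ω _ P _ s hindep hlaw => ?_⟩
  · have h0 := HybridSystem.fimObs_zero_eq_zero hp hNR hdvd hWH hσ ha hb hM hMdot S hk
    exact ⟨h0, by rw [HybridSystem.fimObs_comm, h0]⟩
  · rw [← hS]
    exact HybridSystem.pcrbTheta_eq_pcrbFormula hp hNR hdvd hWH hσ ha hb hM hMdot hL S
  · filter_upwards [ae_tendsto_empirical_second_moment hindep hlaw] with ω hω
    have hcov := HybridSystem.tendsto_sampleCov (sys := sys) hω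
    exact ⟨fun i j => tendsto_pi_nhds.1 (tendsto_pi_nhds.1 hcov i) j,
      HybridSystem.tendsto_pcrbTheta_div hp hNR hdvd hWH hσ ha hb hM hMdot hcov⟩
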